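/- For $n\ge 3$, a $2$-dimensional hypertree on the vertex set $[n]=\{1,\dots,n\}$ is a $2$-dimensional simplicial complex $S$ on $[n]$ with complete $1$-skeleton and exactly $\binom{n-1}{2}$ triangular faces such that $H_1(S,\mathbb{Z})$ is finite. The determinantal hypertree $T_n$ is the random hypertree that takes the value $S$ with probability $|H_1(S,\mathbb{Z})|^2/n^{\binom{n-2}{2}}$ for every hypertree $S$ on $[n]$. Fix a positive integer $h$, and let $\mathcal{G}_n$ be the set of graphs on $[n]$ consisting of $h$ vertex-disjoint $5$-cycles and $n-5h$ isolated vertices. Identify a graph $G$ on $[n]$ with the $1$-cochain in $C^1(T_n,\mathbb{F}_2)$ whose support is the edge set of $G$, and let \[X_n=|\{G\in\mathcal{G}_n : G\in Z^1(T_n,\mathbb{F}_2)\}|\] be the number of graphs in $\mathcal{G}_n$ that are $\mathbb{F}_2$-cocycles of $T_n$. Then for all large enough $n$ (depending on $h$), \[\mathbb{E}X_n\ge\frac{e^{-100h}}{h!}\qquad\text{and}\qquad\mathbb{E}X_n^2\le\frac{(100h)^{5h}}{(h!)^2}.\] -/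

import Mathlib

open MeasureTheory Filter
open scoped Nat ENNReal

noncomputable section

namespace DetHypertree

/-- The coefficient of `τ` in the oriented simplicial boundary of `σ`, the vertices being ordered
increasingly: if `σ = {x₀ < x₁ < ⋯ < x_d}` and `τ = σ \ {x_i}`, it is `(-1) ^ i`; otherwise it
is `0`. -/
def incidence {n : ℕ} (τ σ : Finset (Fin n)) : ℤ :=
  ∑ x ∈ σ, if τ = σ.erase x then (-1) ^ (σ.filter (· < x)).card else 0

/-- The `d`-dimensional faces of a simplicial complex. -/
abbrev Face {n : ℕ} (S : AbstractSimplicialComplex (Fin n)) (d : ℕ) : Type :=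
  {σ : Finset (Fin n) // σ ∈ S.faces ∧ σ.card = d + 1}

instance {n : ℕ} (S : AbstractSimplicialComplex (Fin n)) (d : ℕ) : Fintype (Face S d) :=
  Fintype.ofFinite _

/-- The matrix of the boundary map from `(d+1)`-chains to `d`-chains with coefficients in `R`. -/
def boundaryMatrix {n : ℕ} (S : AbstractSimplicialComplex (Fin n)) (R : Type) [CommRing R]
    (d : ℕ) : Matrix (Face S d) (Face S (d + 1)) R :=
  fun τ σ => (incidence τ.1 σ.1 : R)

/-- The boundary map `C_{d+1}(S, R) → C_d(S, R)`. -/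
def boundary {n : ℕ} (S : AbstractSimplicialComplex (Fin n)) (R : Type) [CommRing R] (d : ℕ) :
    (Face S (d + 1) → R) →ₗ[R] (Face S d → R) :=
  (boundaryMatrix S R d).mulVecLin

/-- The coboundary map `C^d(S, R) → C^{d+1}(S, R)`. -/
def coboundary {n : ℕ} (S : AbstractSimplicialComplex (Fin n)) (R : Type) [CommRing R] (d : ℕ) :
    (Face S d → R) →ₗ[R] (Face S (d + 1) → R) :=
  (boundaryMatrix S R d).transpose.mulVecLin

/-- The first simplicial homology group `H₁(S, R)`: 1-cycles modulo boundaries of 2-chains. -/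
abbrev H1 {n : ℕ} (S : AbstractSimplicialComplex (Fin n)) (R : Type) [CommRing R] : Type :=
  LinearMap.ker (boundary S R 0) ⧸
    (LinearMap.range (boundary S R 1)).submoduleOf (LinearMap.ker (boundary S R 0))

/-- The module of 1-cocycles `Z¹(S, R)`. -/
def Z1 {n : ℕ} (S : AbstractSimplicialComplex (Fin n)) (R : Type) [CommRing R] :
    Submodule R (Face S 1 → R) :=
  LinearMap.ker (coboundary S R 1)

/-- `S` is a 2-dimensional hypertree on `n` vertices. -/
structure IsHypertree {n : ℕ} (S : AbstractSimplicialComplex (Fin n)) : Prop where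
  /-- there are no faces of dimension greater than 2 -/
  dim_le : ∀ σ ∈ S.faces, σ.card ≤ 3
  /-- the 1-skeleton is complete -/
  complete : ∀ σ : Finset (Fin n), σ.card = 2 → σ ∈ S.faces
  /-- the number of triangular faces -/
  card_triangles : Fintype.card (Face S 2) = (n - 1).choose 2
  /-- the first integral homology group is finite -/
  finite_H1 : Finite (H1 S ℤ)

/-- The set of 2-dimensional hypertrees on `n` vertices. -/
abbrev Hypertree (n : ℕ) : Type := {S : AbstractSimplicialComplex (Fin n) // IsHypertree S}

instance (n : ℕ) : Finite (AbstractSimplicialComplex (Fin n)) :=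
  Finite.of_injective (fun S => S.faces) fun S T h => by
    cases S; cases T; congr 1; exact PreAbstractSimplicialComplex.ext h

instance (n : ℕ) : MeasurableSpace (Hypertree n) := ⊤

/-- The law of the determinantal hypertree `T_n`: the hypertree `S` has probability
`|H₁(S, ℤ)|² / n ^ C(n-2, 2)`. -/
def law (n : ℕ) : Measure (Hypertree n) :=
  Measure.sum fun S =>
    ((Nat.card (H1 S.1 ℤ) : ℝ≥0∞) ^ 2 / (n : ℝ≥0∞) ^ ((n - 2).choose 2)) • Measure.dirac S

/-- The graphs on `n` vertices that consist of `h` vertex-disjoint 5-cycles and `n - 5h` isolated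
vertices; the addition in `Fin 5` is modulo 5. -/
def fiveCycleGraphs (n h : ℕ) : Set (SimpleGraph (Fin n)) :=
  {G | ∃ v : Fin h × Fin 5 → Fin n, Function.Injective v ∧
    G.edgeSet = Set.range fun p : Fin h × Fin 5 => s(v p, v (p.1, p.2 + 1))}

open Classical in
/-- The 1-cochain with coefficients in `𝔽₂` whose support is the edge set of `G`. -/
def graphCochain {n : ℕ} (S : AbstractSimplicialComplex (Fin n)) (G : SimpleGraph (Fin n)) :
    Face S 1 → ZMod 2 :=
  fun e => if ∃ a b, G.Adj a b ∧ e.1 = {a, b} then 1 else 0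

/-- The number of graphs consisting of `h` vertex-disjoint 5-cycles and isolated vertices that are
cocycles of `S` over `𝔽₂`. -/
def X {n : ℕ} (h : ℕ) (S : Hypertree n) : ℕ :=
  {G | G ∈ fiveCycleGraphs n h ∧ graphCochain S.1 G ∈ Z1 S.1 (ZMod 2)}.ncard

end DetHypertree

end

/-! Fix a base vertex `b` and keep only the rows of the boundary matrix of the complete 2-complex
that are indexed by edges avoiding `b`. The squared maximal minor on a column set `A` is the squared
order of the first homology if `A` spans a hypertree (`natCard_H1_sq`), and zero otherwise. By
Cauchy–Binet (`det_gram`), the expectation of a product of triangle weights over T_n is then the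
determinant of a weighted up-Laplacian divided by n^C(n-2,2). The vertex `b` is arbitrary, so it can
be chosen isolated in whichever graphs are being studied.

First moment. A graph G is a cocycle iff every triangle of T_n has an even number of edges of G. For
5-cycles it is enough to allow the triangles with no edge of G ("flag" triangles) and the five
triangles on consecutive vertices of each cycle, which form a Möbius strip. The determinant for
these factors into the flag determinant and the square of an integer, nonzero because 5 is odd
(`det_gram_flagTri_mobiusTri`, `det_mobiusMatrix_ne_zero`). For the flag part, the up and down
Laplacians of the complete complex add up to n, whence n·1 - `badLap` = `flagLap` · (1 + DᵀD), where
D = `rowDown`. The determinant of the last factor is at most Cayley's n^(n-2), and `badLap` is small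
because G is sparse (`le_det_flagLap`). Each G is thus a cocycle with probability at least e^(-30h)
n^(-5h) (`le_weight_evenOn_div`), and there are at least n^(5h) / (2 (10h)^h) such graphs.

Second moment. If G₁ and G₂ are both cocycles and H is their union, every triangle of T_n is flag
for H or contains two edges of H (a "cherry"). Nonsingularity forces at least |E(H)| cherry
triangles (`card_edges_le_card_inter_cherryTri`). Giving cherry triangles weight 1 + n, as in an
exponential Markov inequality, bounds the probability by 4^#cherries / n^|E(H)|
(`sum_weight_evenOn_pair_le`). All degrees in H on its vertex set V are at least 2, so |V| ≤ |E(H)|;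
equality makes H 2-regular with at most |V| cherries, while strict inequality gains a factor 1/n
(`pow_cherryTri_div_le`). It remains to sum n^(-|V|) over pairs of labellings, each graph having at
least h! labellings. -/

noncomputable section

namespace DetHypertree

/-! ### Cauchy–Binet, determinant estimates and lattice index -/

section LinearAlgebra

open Matrix Finset

variable {m T R : Type*} [Fintype T] [DecidableEq T] [CommRing R]

/-- The weighted Gram matrix `∑ t, w t • M_t M_tᵀ` of the columns of `M`. -/
def gram (M : Matrix m T R) (w : T → R) : Matrix m m R := M * diagonal w * Mᵀ

theorem gram_apply (M : Matrix m T R) (w : T → R) (i j : m) :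
    gram M w i j = ∑ t, M i t * w t * M j t := by
  rw [gram, Matrix.mul_apply]
  simp [Matrix.mul_diagonal]

theorem gram_posSemidef [Fintype m] (M : Matrix m T ℝ) {w : T → ℝ} (hw : ∀ t, 0 ≤ w t) :
    (gram M w).PosSemidef := by
  have h := (PosSemidef.diagonal hw).mul_mul_conjTranspose_same M
  simpa [gram, conjTranspose_eq_transpose_of_trivial] using h

variable [Fintype m] [DecidableEq m]

/-- Row `i` of the Gram matrix is a combination of the columns of `M`, so multilinearity expands the
determinant over all choices `f` of one column per row. The weights factor out as ∏ w (f i), and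
Cauchy–Binet follows by grouping the `f` by image. -/
theorem det_gram_eq_sum_fun (M : Matrix m T R) (w : T → R) :
    (gram M w).det =
      ∑ f : m → T, (∏ i, w (f i)) * ((∏ i, M i (f i)) * (Mᵀ.submatrix f id).det) := by
  have h : gram M w = fun i => ∑ t, (M i t * w t) • Mᵀ t := by
    ext i j
    simp [gram_apply, Finset.sum_apply]
  have h2 := (detRowAlternating (n := m) (R := R)).toMultilinearMap.map_sum
    (fun i t => (M i t * w t) • Mᵀ t)
  have h3 : (gram M w).det = ∑ f : m → T,
      detRowAlternating (fun i => (M i (f i) * w (f i)) • Mᵀ (f i)) := by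
    rw [h]; exact h2
  rw [h3]
  refine Finset.sum_congr rfl fun f _ => ?_
  have h4 := (detRowAlternating (n := m) (R := R)).toMultilinearMap.map_smul_univ
    (fun i => M i (f i) * w (f i)) (fun i => Mᵀ (f i))
  refine h4.trans ?_
  rw [smul_eq_mul, Finset.prod_mul_distrib]
  change _ * (Mᵀ.submatrix f id).det = _
  ring

/-- **Cauchy–Binet formula** for weighted Gram matrices. -/
theorem det_gram (M : Matrix m T R) (w : T → R) :
    (gram M w).det = ∑ A ∈ powersetCard (Fintype.card m) (univ : Finset T),
      (∏ t ∈ A, w t) * (gram M fun t => if t ∈ A then 1 else 0).det := by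
  simp_rw [det_gram_eq_sum_fun M, Finset.mul_sum]
  rw [Finset.sum_comm]
  refine Finset.sum_congr rfl fun f _ => ?_
  -- With indicator weights of `A`, the term of `f` survives only if `f` takes values in `A`. For
  -- injective `f` and |A| = |m| this leaves `A` equal to the image of `f`; for other `f` the minor
  -- has a repeated row.
  by_cases hf : Function.Injective f
  · have hc : (univ.image f).card = Fintype.card m := by
      rw [Finset.card_image_of_injective _ hf, Finset.card_univ]
    rw [Finset.sum_eq_single_of_mem (univ.image f) (by simp [Finset.mem_powersetCard, hc])]
    · rw [Finset.prod_image fun _ _ _ _ h => hf h]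
      simp
    · intro A hA hne
      obtain ⟨i, hi⟩ : ∃ i, f i ∉ A := by
        by_contra! hcon
        refine hne (Finset.eq_of_subset_of_card_le ?_ ?_).symm
        · exact Finset.image_subset_iff.2 fun i _ => hcon i
        · rw [(Finset.mem_powersetCard.1 hA).2, hc]
      rw [Finset.prod_eq_zero (Finset.mem_univ i) (if_neg hi)]
      simp
  · have h0 : (Mᵀ.submatrix f id).det = 0 := by
      obtain ⟨i, j, hij, hne⟩ : ∃ i j, f i = f j ∧ i ≠ j := by
        simpa [Function.Injective] using hf
      exact det_zero_of_row_eq hne (by ext k; simp [hij])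
    simp [h0]

theorem det_gram_nonneg (M : Matrix m T ℝ) {w : T → ℝ} (hw : ∀ t, 0 ≤ w t) :
    0 ≤ (gram M w).det :=
  (gram_posSemidef M hw).det_nonneg

theorem det_gram_indicator_nonneg (M : Matrix m T ℝ) (A : Finset T) :
    0 ≤ (gram M fun t => if t ∈ A then 1 else 0).det :=
  det_gram_nonneg M fun t => by split_ifs <;> norm_num

/-- By Cauchy–Binet the determinant is a polynomial in the weights whose coefficients are squared
minors, hence nonnegative. -/
theorem det_gram_mono (M : Matrix m T ℝ) {w w' : T → ℝ} (hw : ∀ t, 0 ≤ w t)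
    (hww' : ∀ t, w t ≤ w' t) : (gram M w).det ≤ (gram M w').det := by
  rw [det_gram M w, det_gram M w']
  refine Finset.sum_le_sum fun A _ => ?_
  exact mul_le_mul_of_nonneg_right
    (Finset.prod_le_prod (fun t _ => hw t) fun t _ => hww' t) (det_gram_indicator_nonneg M A)

/-- The weighted sum of the squared maximal minors over column sets inside `K`. -/
theorem sum_det_gram_indicator (M : Matrix m T R) (K : Finset T) :
    ∑ A ∈ powersetCard (Fintype.card m) K, (gram M fun t => if t ∈ A then 1 else 0).det =
      (gram M fun t => if t ∈ K then 1 else 0).det := by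
  rw [det_gram M fun t => if t ∈ K then 1 else 0]
  refine Finset.sum_subset_zero_on_sdiff ?_ ?_ ?_
  · exact Finset.powersetCard_mono (Finset.subset_univ K)
  · intro A hA
    simp only [Finset.mem_sdiff, Finset.mem_powersetCard, Finset.subset_univ, true_and,
      not_and] at hA
    obtain ⟨t, ht, htK⟩ := Finset.not_subset.1 fun h => hA.2 h hA.1
    rw [Finset.prod_eq_zero ht (if_neg htK), zero_mul]
  · intro A hA
    have hA := (Finset.mem_powersetCard.1 hA).1
    rw [Finset.prod_eq_one fun t ht => if_pos (hA ht), one_mul]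

/-- A positive semidefinite matrix has determinant at most `c ^ d` if its diagonal is at most
`c`. -/
theorem det_le_pow_of_diag_le {Q : Matrix m m ℝ} (hQ : Q.PosSemidef) {c : ℝ}
    (hc : ∀ i, Q i i ≤ c) : Q.det ≤ c ^ Fintype.card m := by
  rcases isEmpty_or_nonempty m with hm | hm
  · simp
  have hN : (0 : ℝ) < Fintype.card m := by exact_mod_cast Fintype.card_pos
  set ev := hQ.isHermitian.eigenvalues
  have hpos : ∀ i, 0 ≤ ev i := hQ.eigenvalues_nonneg
  have hdet : Q.det = ∏ i, ev i := by
    simpa using hQ.isHermitian.det_eq_prod_eigenvalues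
  have htr : ∑ i, ev i ≤ Fintype.card m * c := by
    have : Q.trace = ∑ i, ev i := by simpa using hQ.isHermitian.trace_eq_sum_eigenvalues
    rw [← this, Matrix.trace]
    calc ∑ i, Q.diag i ≤ ∑ _i : m, c := Finset.sum_le_sum fun i _ => hc i
      _ = _ := by simp
  -- AM–GM for the eigenvalues, whose product is the determinant and whose sum is the trace.
  have h := Real.geom_mean_le_arith_mean univ (fun _ => (1 : ℝ)) ev (by simp)
    (by simpa using hN) (fun i _ => hpos i)
  simp only [Real.rpow_one, sum_const, card_univ, nsmul_eq_mul, mul_one, one_mul] at h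
  have hp : 0 ≤ ∏ i, ev i := Finset.prod_nonneg fun i _ => hpos i
  have h2 : (∏ i, ev i) ^ ((Fintype.card m : ℝ)⁻¹) ≤ c :=
    h.trans ((div_le_iff₀ hN).2 (by linarith))
  have h3 := pow_le_pow_left₀ (by positivity) h2 (Fintype.card m)
  rwa [Real.rpow_inv_natCast_pow hp Fintype.card_ne_zero, ← hdet] at h3

/-- Lower bound for the determinant of a perturbation of a multiple of the identity. -/
theorem pow_mul_exp_le_det_smul_one_sub {E : Matrix m m ℝ} (hE : E.PosSemidef) {c : ℝ}
    (hc : 0 < c) (hrow : ∀ i, ∑ j, |E i j| ≤ c / 2) :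
    c ^ Fintype.card m * Real.exp (-(2 * E.trace / c)) ≤ (c • (1 : Matrix m m ℝ) - E).det := by
  set ev := hE.isHermitian.eigenvalues with hev
  have hpos : ∀ i, 0 ≤ ev i := hE.eigenvalues_nonneg
  -- Gershgorin: each eigenvalue lies in a disc about a diagonal entry with radius the off-diagonal
  -- row sum.
  have hle : ∀ i, ev i ≤ c / 2 := by
    intro i
    have hspec : ev i ∈ spectrum ℝ E := hE.isHermitian.eigenvalues_mem_spectrum_real i
    have hval : Module.End.HasEigenvalue (Matrix.toLin' E) (ev i) := by
      rw [Module.End.hasEigenvalue_iff_mem_spectrum]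
      rwa [Matrix.spectrum_toLin']
    obtain ⟨k, hk⟩ := eigenvalue_mem_ball hval
    have h1 := hrow k
    rw [← Finset.add_sum_erase _ _ (Finset.mem_univ k)] at h1
    rw [Metric.mem_closedBall, Real.dist_eq] at hk
    have h2 := le_abs_self (E k k)
    have h3 := le_abs_self (ev i - E k k)
    simp only [Real.norm_eq_abs] at hk
    linarith
  have hdet : (c • (1 : Matrix m m ℝ) - E).det = ∏ i, (c - ev i) := by
    have h1 := hE.isHermitian.charpoly_eq
    have h2 := Matrix.eval_charpoly E c
    rw [h1] at h2
    simp only [Polynomial.eval_prod, Polynomial.eval_sub, Polynomial.eval_X,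
      Polynomial.eval_C] at h2
    have h3 : Matrix.scalar m c = c • (1 : Matrix m m ℝ) := by
      rw [smul_one_eq_diagonal]; rfl
    rw [← h3]
    exact h2.symm
  have htr : E.trace = ∑ i, ev i := by simpa using hE.isHermitian.trace_eq_sum_eigenvalues
  rw [hdet, htr, Finset.mul_sum, Finset.sum_div, ← Finset.sum_neg_distrib, Real.exp_sum,
    ← Finset.card_univ, ← Finset.prod_const, ← Finset.prod_mul_distrib]
  refine Finset.prod_le_prod (fun i _ => by positivity) fun i _ => ?_
  set x := ev i / c with hx
  have hx0 : 0 ≤ x := div_nonneg (hpos i) hc.le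
  have hx1 : x ≤ 1 / 2 := by
    rw [hx, div_le_iff₀ hc]; linarith [hle i]
  have hxe : ev i = c * x := by rw [hx]; field_simp
  -- For 0 ≤ x ≤ 1/2, (1 - x)(1 + 2x) ≥ 1 and e^(2x) ≥ 1 + 2x.
  have h1 : Real.exp (-(2 * ev i / c)) ≤ 1 - x := by
    have h2 : 2 * ev i / c = 2 * x := by rw [hx]; ring
    rw [h2, Real.exp_neg]
    have h3 := Real.add_one_le_exp (2 * x)
    rw [inv_le_comm₀ (Real.exp_pos _) (by linarith)]
    refine le_trans ?_ h3
    rw [inv_le_iff_one_le_mul₀ (by linarith)]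
    nlinarith
  calc c * Real.exp (-(2 * ev i / c)) ≤ c * (1 - x) := by gcongr
    _ = c - ev i := by rw [hxe]; ring

/-- The index of the column lattice of a square integer matrix is the absolute value of its
determinant; both are zero if the index is infinite. -/
theorem natCard_quotient_range_mulVecLin (A : Matrix m m ℤ) :
    Nat.card ((m → ℤ) ⧸ LinearMap.range A.mulVecLin) = A.det.natAbs := by
  by_cases hA : A.det = 0
  · rw [hA, Int.natAbs_zero]
    by_contra hne
    set N := LinearMap.range A.mulVecLin
    set k := Nat.card ((m → ℤ) ⧸ N)
    -- A finite index `k` annihilates the quotient, so k·1 factors through `A`; a singular `A` then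
    -- forces k = 0.
    have hmem : ∀ x : m → ℤ, k • x ∈ N := by
      intro x
      rw [← Submodule.Quotient.mk_eq_zero, Submodule.Quotient.mk_smul]
      exact card_nsmul_eq_zero'
    choose y hy using fun i => hmem (Pi.single i 1)
    have hmul : A * (Matrix.of y)ᵀ = (k : ℤ) • (1 : Matrix m m ℤ) := by
      ext i j
      have h1 : (A * (Matrix.of y)ᵀ) i j = (k • (Pi.single j 1 : m → ℤ)) i := congrFun (hy j) i
      rw [h1]
      simp [Matrix.one_apply, Pi.single_apply]
    have hd := congrArg Matrix.det hmul
    rw [Matrix.det_mul, hA, zero_mul, Matrix.det_smul, Matrix.det_one, mul_one] at hd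
    exact hne (by exact_mod_cast eq_zero_of_pow_eq_zero hd.symm)
  · have hinj : Function.Injective A.mulVecLin := by
      rw [← LinearMap.ker_eq_bot, LinearMap.ker_eq_bot']
      intro x hx
      by_contra hx0
      exact hA (Matrix.exists_mulVec_eq_zero_iff.1 ⟨x, hx0, hx⟩)
    have h := Submodule.natAbs_det_equiv (LinearMap.range A.mulVecLin)
      (LinearEquiv.ofInjective A.mulVecLin hinj)
    rw [← h, ← LinearMap.det_toLin' A]
    rfl

end LinearAlgebra

/-! ### Signs of incidences and the Laplacians of the complete complex -/

section Incidence

open Finset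

variable {n : ℕ}

/-- The sign of an ordered pair of vertices. -/
def sg (x y : Fin n) : ℤ := if x < y then -1 else 1

theorem sg_mul_self (x y : Fin n) : sg x y * sg x y = 1 := by
  unfold sg; split_ifs <;> rfl

theorem sg_swap {x y : Fin n} (h : x ≠ y) : sg y x = -sg x y := by
  unfold sg
  rcases lt_or_gt_of_ne h with h | h <;> simp [h, h.not_gt]

/-- The sign records the parity of the number of vertices of `τ` below `x`, so it is a product over
`τ`. All later sign computations reduce to `sg`. -/
theorem incidence_insert {τ : Finset (Fin n)} {x : Fin n} (hx : x ∉ τ) :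
    incidence τ (insert x τ) = ∏ y ∈ τ, sg y x := by
  unfold incidence
  rw [Finset.sum_eq_single x]
  · rw [if_pos (Finset.erase_insert hx).symm, Finset.filter_insert, if_neg (lt_irrefl x)]
    unfold sg
    rw [Finset.prod_ite]
    simp
  · intro y hy hyx
    refine if_neg fun h => hx ?_
    rw [h]
    exact Finset.mem_erase.2 ⟨hyx.symm, Finset.mem_insert_self _ _⟩
  · intro h
    exact absurd (Finset.mem_insert_self _ _) h

theorem exists_eq_insert_of_incidence_ne_zero {τ σ : Finset (Fin n)} (h : incidence τ σ ≠ 0) :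
    ∃ x ∉ τ, σ = insert x τ := by
  obtain ⟨x, hx, hne⟩ := Finset.exists_ne_zero_of_sum_ne_zero h
  have hτ : τ = σ.erase x := by
    by_contra hcon
    exact hne (if_neg hcon)
  exact ⟨x, by simp [hτ], by rw [hτ, Finset.insert_erase hx]⟩

theorem subset_of_incidence_ne_zero {τ σ : Finset (Fin n)} (h : incidence τ σ ≠ 0) : τ ⊆ σ := by
  obtain ⟨x, -, rfl⟩ := exists_eq_insert_of_incidence_ne_zero h
  exact Finset.subset_insert _ _

theorem incidence_mul_self {τ σ : Finset (Fin n)} (h : incidence τ σ ≠ 0) :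
    incidence τ σ * incidence τ σ = 1 := by
  obtain ⟨x, hx, rfl⟩ := exists_eq_insert_of_incidence_ne_zero h
  rw [incidence_insert hx, ← Finset.prod_mul_distrib]
  exact Finset.prod_eq_one fun y _ => sg_mul_self y x

theorem incidence_pair {u x : Fin n} (h : u ≠ x) : incidence {u} {u, x} = sg u x := by
  rw [Finset.pair_comm, incidence_insert (by simpa using h.symm), Finset.prod_singleton]

theorem incidence_triple {u x y : Fin n} (hux : u ≠ x) (huy : u ≠ y) (hxy : x ≠ y) :
    incidence {u, x} {u, x, y} = sg u y * sg x y := by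
  have h : ({u, x, y} : Finset (Fin n)) = insert y {u, x} := by ext; simp; tauto
  rw [h, incidence_insert (by simp [huy.symm, hxy.symm]), Finset.prod_pair hux]

theorem incidence_triple' {u x y : Fin n} (hux : u ≠ x) (huy : u ≠ y) (hxy : x ≠ y) :
    incidence {u, y} {u, x, y} = sg u x * sg y x := by
  rw [Finset.pair_comm x y]
  exact incidence_triple huy hux hxy.symm

theorem pair_ne_pair {u x y : Fin n} (hxy : x ≠ y) : ({u, x} : Finset (Fin n)) ≠ {u, y} := by
  intro h
  have h1 : x ∈ ({u, y} : Finset (Fin n)) := by rw [← h]; simp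
  have h2 : y ∈ ({u, x} : Finset (Fin n)) := by rw [h]; simp
  simp only [Finset.mem_insert, Finset.mem_singleton] at h1 h2
  grind

theorem exists_eq_triple {t : Finset (Fin n)} (ht : t.card = 3) {v : Fin n} (hv : v ∈ t) :
    ∃ x y, v ≠ x ∧ v ≠ y ∧ x ≠ y ∧ t = {v, x, y} := by
  have h : (t.erase v).card = 2 := by rw [Finset.card_erase_of_mem hv, ht]
  obtain ⟨x, y, hxy, he⟩ := Finset.card_eq_two.1 h
  have hx : x ∈ t.erase v := by simp [he]
  have hy : y ∈ t.erase v := by simp [he]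
  refine ⟨x, y, (Finset.ne_of_mem_erase hx).symm, (Finset.ne_of_mem_erase hy).symm, hxy, ?_⟩
  rw [← he, Finset.insert_erase hv]

theorem exists_eq_pair {e : Finset (Fin n)} (he : e.card = 2) {v : Fin n} (hv : v ∈ e) :
    ∃ x, v ≠ x ∧ e = {v, x} := by
  obtain ⟨x, y, hxy, rfl⟩ := Finset.card_eq_two.1 he
  simp only [Finset.mem_insert, Finset.mem_singleton] at hv
  rcases hv with rfl | rfl
  · exact ⟨y, hxy, rfl⟩
  · exact ⟨x, hxy.symm, Finset.pair_comm _ _⟩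

/-- The boundary of a boundary vanishes, for any indexing of edges that covers the edges of the
triangle. -/
theorem sum_incidence_mul_incidence {ι : Type*} [Fintype ι] (ed : ι → Finset (Fin n))
    (hed : Function.Injective ed) (v : Fin n) {t : Finset (Fin n)} (ht : t.card = 3)
    (hcov : ∀ e ⊆ t, e.card = 2 → ∃ i, ed i = e) :
    ∑ i, incidence {v} (ed i) * incidence (ed i) t = 0 := by
  by_cases hv : v ∈ t
  · obtain ⟨x, y, hvx, hvy, hxy, rfl⟩ := exists_eq_triple ht hv
    obtain ⟨i, hi⟩ := hcov {v, x} (by intro z; simp; tauto) (Finset.card_pair hvx)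
    obtain ⟨j, hj⟩ := hcov {v, y} (by intro z; simp; tauto) (Finset.card_pair hvy)
    have hij : i ≠ j := by
      rintro rfl
      exact pair_ne_pair hxy (hi.symm.trans hj)
    rw [Fintype.sum_eq_add i j hij, hi, hj, incidence_pair hvx, incidence_pair hvy,
      incidence_triple hvx hvy hxy, incidence_triple' hvx hvy hxy, sg_swap hxy]
    · ring
    · rintro k ⟨hki, hkj⟩
      by_contra hne
      obtain ⟨z, hz, hk⟩ := exists_eq_insert_of_incidence_ne_zero (left_ne_zero_of_mul hne)
      have hsub := subset_of_incidence_ne_zero (right_ne_zero_of_mul hne)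
      have hzt : z ∈ ({v, x, y} : Finset (Fin n)) := hsub (by rw [hk]; simp)
      simp only [Finset.mem_insert, Finset.mem_singleton] at hzt hz
      rcases hzt with rfl | rfl | rfl
      · exact hz rfl
      · exact hki (hed (by rw [hk, hi, Finset.pair_comm]))
      · exact hkj (hed (by rw [hk, hj, Finset.pair_comm]))
  · refine Finset.sum_eq_zero fun i _ => ?_
    by_contra hne
    have h1 := subset_of_incidence_ne_zero (left_ne_zero_of_mul hne)
    have h2 := subset_of_incidence_ne_zero (right_ne_zero_of_mul hne)
    exact hv (h2 (h1 (by simp)))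

/-- The triangles on `n` vertices. -/
abbrev Tri (n : ℕ) : Type := {t : Finset (Fin n) // t.card = 3}

theorem sum_incidence_sq {e : Finset (Fin n)} (he : e.card = 2) :
    ∑ t : Tri n, incidence e t.1 * incidence e t.1 = n - 2 := by
  have h := Fintype.sum_of_injective
    (fun x : {x // x ∉ e} => (⟨insert x.1 e, by rw [Finset.card_insert_of_notMem x.2, he]⟩ : Tri n))
    ?_ (fun _ => (1 : ℤ)) (fun t => incidence e t.1 * incidence e t.1) ?_ ?_
  · rw [← h]
    have hc : Fintype.card {x // x ∉ e} = n - 2 := by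
      rw [Fintype.card_subtype_compl, Fintype.card_fin, Fintype.card_coe, he]
    have hn : 2 ≤ n := by
      have := Finset.card_le_univ e
      rwa [he, Fintype.card_fin] at this
    simp only [Finset.sum_const, Finset.card_univ, hc, nsmul_eq_mul, mul_one]
    omega
  · intro x y hxy
    have h1 : x.1 ∈ insert y.1 e := by
      have h2 : insert x.1 e = insert y.1 e := congrArg Subtype.val hxy
      rw [← h2]; simp
    exact Subtype.ext ((Finset.mem_insert.1 h1).resolve_right x.2)
  · intro t ht
    by_contra hne
    obtain ⟨x, hx, hk⟩ := exists_eq_insert_of_incidence_ne_zero (left_ne_zero_of_mul hne)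
    exact ht ⟨⟨x, hx⟩, Subtype.ext hk.symm⟩
  · intro x
    refine (incidence_mul_self ?_).symm
    rw [incidence_insert x.2]
    refine Finset.prod_ne_zero_iff.2 fun y _ => ?_
    unfold sg; split_ifs <;> norm_num

/-- Distinct edges with a common vertex lie in exactly one common triangle, and the product of signs
there is opposite to the product at the vertex. Disjoint edges share neither a vertex nor a
triangle. -/
theorem sum_incidence_singleton_mul {e e' : Finset (Fin n)} (he : e.card = 2) (he' : e'.card = 2) :
    ∑ v, incidence {v} e * incidence {v} e' =
      if e = e' then 2 else -∑ t : Tri n, incidence e t.1 * incidence e' t.1 := by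
  split_ifs with h
  · subst h
    obtain ⟨x, y, hxy, rfl⟩ := Finset.card_eq_two.1 he
    rw [Fintype.sum_eq_add x y hxy]
    · rw [incidence_pair hxy, Finset.pair_comm x y, incidence_pair hxy.symm, sg_mul_self,
        sg_mul_self]
      rfl
    · rintro z ⟨hzx, hzy⟩
      by_contra hne
      have := subset_of_incidence_ne_zero (left_ne_zero_of_mul hne)
      simp [hzx, hzy] at this
  · by_cases hd : ∃ u, u ∈ e ∧ u ∈ e'
    · obtain ⟨u, hu, hu'⟩ := hd
      obtain ⟨x, hux, rfl⟩ := exists_eq_pair he hu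
      obtain ⟨y, huy, rfl⟩ := exists_eq_pair he' hu'
      have hxy : x ≠ y := by rintro rfl; exact h rfl
      rw [Fintype.sum_eq_single u, Fintype.sum_eq_single
        (⟨{u, x, y}, Finset.card_eq_three.2 ⟨u, x, y, hux, huy, hxy, rfl⟩⟩ : Tri n)]
      · rw [incidence_pair hux, incidence_pair huy, incidence_triple hux huy hxy,
          incidence_triple' hux huy hxy, sg_swap hxy]
        linear_combination (-sg u x * sg u y) * sg_mul_self x y
      · intro t ht
        by_contra hne
        have h1 := subset_of_incidence_ne_zero (left_ne_zero_of_mul hne)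
        have h2 := subset_of_incidence_ne_zero (right_ne_zero_of_mul hne)
        refine ht (Subtype.ext (Finset.eq_of_subset_of_card_le ?_ ?_).symm)
        · intro z hz
          simp only [Finset.mem_insert, Finset.mem_singleton] at hz
          rcases hz with rfl | rfl | rfl
          · exact h1 (by simp)
          · exact h1 (by simp)
          · exact h2 (by simp)
        · rw [t.2, Finset.card_eq_three.2 ⟨u, x, y, hux, huy, hxy, rfl⟩]
      · intro z hz
        by_contra hne
        have h1 := subset_of_incidence_ne_zero (left_ne_zero_of_mul hne)
        have h2 := subset_of_incidence_ne_zero (right_ne_zero_of_mul hne)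
        simp only [Finset.singleton_subset_iff, Finset.mem_insert, Finset.mem_singleton] at h1 h2
        grind
    · push Not at hd
      rw [Finset.sum_eq_zero, Finset.sum_eq_zero, neg_zero]
      · intro t _
        by_contra hne
        have h1 := subset_of_incidence_ne_zero (left_ne_zero_of_mul hne)
        have h2 := subset_of_incidence_ne_zero (right_ne_zero_of_mul hne)
        have h3 := Finset.card_le_card (Finset.union_subset h1 h2)
        rw [Finset.card_union_of_disjoint (Finset.disjoint_left.2 hd), he, he', t.2] at h3
        omega
      · intro v _
        by_contra hne
        have h1 := subset_of_incidence_ne_zero (left_ne_zero_of_mul hne)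
        have h2 := subset_of_incidence_ne_zero (right_ne_zero_of_mul hne)
        exact hd v (h1 (by simp)) (h2 (by simp))

/-- The up and down Laplacians of the complete complex on edges add up to `n`. -/
theorem sum_incidence_add_sum_incidence {e e' : Finset (Fin n)} (he : e.card = 2)
    (he' : e'.card = 2) :
    ∑ t : Tri n, incidence e t.1 * incidence e' t.1 + ∑ v, incidence {v} e * incidence {v} e' =
      if e = e' then (n : ℤ) else 0 := by
  rw [sum_incidence_singleton_mul he he']
  split_ifs with h
  · subst h
    rw [sum_incidence_sq he]; ring
  · ring

end Incidence

/-! ### The order of the first homology as a reduced minor -/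

section Homology

open Finset Matrix

variable {n : ℕ}

/-- `e` is the vertex set of an edge of `G`. -/
def IsEdge (G : SimpleGraph (Fin n)) (e : Finset (Fin n)) : Prop := ∃ x y, G.Adj x y ∧ e = {x, y}

instance (G : SimpleGraph (Fin n)) : DecidablePred (IsEdge G) := Classical.decPred _

theorem isEdge_pair {G : SimpleGraph (Fin n)} {x y : Fin n} : IsEdge G {x, y} ↔ G.Adj x y := by
  constructor
  · rintro ⟨a, b, hab, h⟩
    have h1 : a ∈ ({x, y} : Finset (Fin n)) := by rw [h]; simp
    have h2 : b ∈ ({x, y} : Finset (Fin n)) := by rw [h]; simp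
    have hne := hab.ne
    simp only [Finset.mem_insert, Finset.mem_singleton] at h1 h2
    rcases h1 with rfl | rfl <;> rcases h2 with rfl | rfl
    · exact absurd rfl hne
    · exact hab
    · exact hab.symm
    · exact absurd rfl hne
  · exact fun h => ⟨x, y, h, rfl⟩

theorem IsEdge.card_eq_two {G : SimpleGraph (Fin n)} {e : Finset (Fin n)} (h : IsEdge G e) :
    e.card = 2 := by
  obtain ⟨x, y, hxy, rfl⟩ := h
  exact Finset.card_pair hxy.ne

theorem not_isEdge_bot (e : Finset (Fin n)) : ¬ IsEdge ⊥ e := by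
  rintro ⟨x, y, h, -⟩
  exact h

/-- The pairs of vertices that avoid the base vertex `b` and are not edges of `G`. -/
abbrev Row (G : SimpleGraph (Fin n)) (b : Fin n) : Type :=
  {e : Finset (Fin n) // e.card = 2 ∧ b ∉ e ∧ ¬ IsEdge G e}

/-- The boundary matrix with rows restricted to `Row G b`. -/
def rowBoundary (G : SimpleGraph (Fin n)) (b : Fin n) (R : Type) [CommRing R] :
    Matrix (Row G b) (Tri n) R :=
  fun e t => (incidence e.1 t.1 : R)

/-- This is the number of triangles of a hypertree, so its reduced boundary matrix is square. -/
theorem card_row_bot (b : Fin n) : Fintype.card (Row ⊥ b) = (n - 1).choose 2 := by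
  rw [Fintype.card_subtype]
  have h : (univ.filter fun e : Finset (Fin n) => e.card = 2 ∧ b ∉ e ∧ ¬ IsEdge ⊥ e) =
      powersetCard 2 (univ.erase b) := by
    ext e
    simp only [mem_filter, mem_univ, true_and, mem_powersetCard, not_isEdge_bot, not_false_eq_true,
      and_true]
    constructor
    · rintro ⟨h1, h2⟩
      exact ⟨fun x hx => by simp only [mem_erase, mem_univ, and_true]; rintro rfl; exact h2 hx, h1⟩
    · rintro ⟨h1, h2⟩
      exact ⟨h2, fun hb => by simpa using h1 hb⟩
  rw [h, card_powersetCard, card_erase_of_mem (mem_univ b), card_univ, Fintype.card_fin]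

variable {S : AbstractSimplicialComplex (Fin n)}

theorem boundary_zero_apply (z : Face S 1 → ℤ) (v : Face S 0) :
    boundary S ℤ 0 z v = ∑ e : Face S 1, incidence v.1 e.1 * z e := by
  simp [boundary, boundaryMatrix, mulVec, dotProduct]

theorem boundary_one_apply (z : Face S 2 → ℤ) (e : Face S 1) :
    boundary S ℤ 1 z e = ∑ t : Face S 2, incidence e.1 t.1 * z t := by
  simp [boundary, boundaryMatrix, mulVec, dotProduct]

theorem singleton_mem_faces (S : AbstractSimplicialComplex (Fin n)) (v : Fin n) :
    {v} ∈ S.faces := S.singleton_mem v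

/-- A non-base edge as a 1-face of a complex with complete 1-skeleton. -/
def rowFace {b : Fin n} (hS : ∀ σ : Finset (Fin n), σ.card = 2 → σ ∈ S.faces) (e : Row ⊥ b) :
    Face S 1 := ⟨e.1, hS _ e.2.1, e.2.1⟩

theorem sum_face_incidence (hS : ∀ σ : Finset (Fin n), σ.card = 2 → σ ∈ S.faces) (v : Fin n)
    {t : Finset (Fin n)} (ht : t.card = 3) :
    ∑ e : Face S 1, incidence {v} e.1 * incidence e.1 t = 0 :=
  sum_incidence_mul_incidence (fun e : Face S 1 => e.1) Subtype.val_injective v ht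
    fun e _ he => ⟨⟨e, hS e he, he⟩, rfl⟩

theorem boundary_one_mem_ker (hS : ∀ σ : Finset (Fin n), σ.card = 2 → σ ∈ S.faces)
    (z : Face S 2 → ℤ) : boundary S ℤ 1 z ∈ LinearMap.ker (boundary S ℤ 0) := by
  rw [LinearMap.mem_ker]
  ext ⟨v, hv, hv1⟩
  obtain ⟨v, rfl⟩ := Finset.card_eq_one.1 hv1
  simp only [boundary_zero_apply, boundary_one_apply, Finset.mul_sum, Pi.zero_apply]
  rw [Finset.sum_comm]
  refine Finset.sum_eq_zero fun t _ => ?_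
  simp_rw [← mul_assoc]
  rw [← Finset.sum_mul, sum_face_incidence hS v t.2.2, zero_mul]

/-- Restriction of 1-cycles to the edges that avoid the base vertex. -/
def restrictCycle (b : Fin n) (hS : ∀ σ : Finset (Fin n), σ.card = 2 → σ ∈ S.faces) :
    LinearMap.ker (boundary S ℤ 0) →ₗ[ℤ] (Row ⊥ b → ℤ) :=
  (LinearMap.funLeft ℤ ℤ (rowFace (b := b) hS)).comp (Submodule.subtype _)

/-- The edges avoiding `b` determine a cycle: if it vanishes on them, the cycle condition at `x`
involves only the edge from `b` to `x`. -/
theorem restrictCycle_injective (b : Fin n)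
    (hS : ∀ σ : Finset (Fin n), σ.card = 2 → σ ∈ S.faces) :
    Function.Injective (restrictCycle b hS) := by
  rw [← LinearMap.ker_eq_bot, LinearMap.ker_eq_bot']
  rintro ⟨z, hz⟩ h
  have hrow : ∀ e : Face S 1, b ∉ e.1 → z e = 0 := fun e he =>
    congrFun h ⟨e.1, e.2.2, he, not_isEdge_bot _⟩
  refine Subtype.ext (funext fun e => ?_)
  change z e = 0
  by_cases he : b ∈ e.1
  · obtain ⟨e, he1, he2⟩ := e
    obtain ⟨x, hbx, rfl⟩ := exists_eq_pair he2 he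
    have h1 := congrFun hz ⟨{x}, singleton_mem_faces S x, Finset.card_singleton x⟩
    rw [boundary_zero_apply, Fintype.sum_eq_single ⟨{b, x}, he1, he2⟩] at h1
    · simp only [Pi.zero_apply, mul_eq_zero] at h1
      refine h1.resolve_left ?_
      rw [Finset.pair_comm, incidence_pair hbx.symm]
      unfold sg; split_ifs <;> norm_num
    · intro e' he'
      by_cases hb : b ∈ e'.1
      · refine mul_eq_zero_of_left ?_ _
        by_contra hne
        have hx : x ∈ e'.1 := subset_of_incidence_ne_zero hne (by simp)
        refine he' (Subtype.ext (Finset.eq_of_subset_of_card_le ?_ ?_).symm)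
        · intro y hy
          simp only [Finset.mem_insert, Finset.mem_singleton] at hy
          rcases hy with rfl | rfl <;> assumption
        · rw [e'.2.2, Finset.card_pair hbx]
      · rw [hrow e' hb, mul_zero]
  · exact hrow e he

/-- Coning from `b`: the boundary of `insert b e` is a cycle whose only edge avoiding `b` is `e`.
The triangle need not be a face of `S`; only its edges matter. -/
theorem restrictCycle_surjective (b : Fin n)
    (hS : ∀ σ : Finset (Fin n), σ.card = 2 → σ ∈ S.faces) :
    Function.Surjective (restrictCycle b hS) := by
  intro y
  have hcard : ∀ e : Row ⊥ b, (insert b e.1).card = 3 := fun e => by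
    rw [Finset.card_insert_of_notMem e.2.2.1, e.2.1]
  have hne : ∀ e : Row ⊥ b, incidence e.1 (insert b e.1) ≠ 0 := fun e => by
    rw [incidence_insert e.2.2.1]
    refine Finset.prod_ne_zero_iff.2 fun y _ => ?_
    unfold sg; split_ifs <;> norm_num
  refine ⟨⟨fun e' => ∑ e : Row ⊥ b, incidence e'.1 (insert b e.1) *
    (incidence e.1 (insert b e.1) * y e), ?_⟩, ?_⟩
  · rw [LinearMap.mem_ker]
    ext ⟨v, hv, hv1⟩
    obtain ⟨v, rfl⟩ := Finset.card_eq_one.1 hv1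
    simp only [boundary_zero_apply, Finset.mul_sum, Pi.zero_apply]
    rw [Finset.sum_comm]
    refine Finset.sum_eq_zero fun e _ => ?_
    simp_rw [← mul_assoc]
    rw [← Finset.sum_mul, ← Finset.sum_mul, sum_face_incidence hS v (hcard e), zero_mul, zero_mul]
  · ext e'
    change ∑ e : Row ⊥ b, incidence e'.1 (insert b e.1) * (incidence e.1 (insert b e.1) * y e) = _
    rw [Fintype.sum_eq_single e']
    · rw [← mul_assoc, incidence_mul_self (hne e'), one_mul]
    · intro e he
      refine mul_eq_zero_of_left ?_ _
      by_contra h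
      refine he (Subtype.ext (Finset.eq_of_subset_of_card_le ?_ ?_).symm)
      · intro x hx
        refine (Finset.mem_insert.1 (subset_of_incidence_ne_zero h hx)).resolve_left ?_
        rintro rfl
        exact e'.2.2.1 hx
      · rw [e.2.1, e'.2.1]

/-- Restricting to edges that avoid `b` identifies the 1-cycles with a free module and the
boundaries with the column lattice of a square matrix, whose index is the absolute determinant. -/
theorem natCard_H1_eq (b : Fin n) (hS : ∀ σ : Finset (Fin n), σ.card = 2 → σ ∈ S.faces)
    (f : Row ⊥ b ≃ Face S 2) :
    Nat.card (H1 S ℤ) =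
      (Matrix.of fun e e' : Row ⊥ b => incidence e.1 (f e').1).det.natAbs := by
  rw [← natCard_quotient_range_mulVecLin]
  let r : LinearMap.ker (boundary S ℤ 0) ≃ₗ[ℤ] (Row ⊥ b → ℤ) :=
    LinearEquiv.ofBijective (restrictCycle b hS)
      ⟨restrictCycle_injective b hS, restrictCycle_surjective b hS⟩
  have happ : ∀ (z : Face S 2 → ℤ) (e : Row ⊥ b), boundary S ℤ 1 z (rowFace hS e) =
      ((Matrix.of fun e e' : Row ⊥ b => incidence e.1 (f e').1).mulVecLin (z ∘ f)) e := by
    intro z e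
    rw [boundary_one_apply, Matrix.mulVecLin_apply]
    simp only [mulVec, dotProduct, Matrix.of_apply, Function.comp_apply, rowFace]
    exact (Equiv.sum_comp f fun t => incidence e.1 t.1 * z t).symm
  refine Nat.card_congr (Submodule.Quotient.equiv _ _ r ?_).toEquiv
  ext x
  constructor
  · rintro ⟨⟨z, hz⟩, hzr, rfl⟩
    obtain ⟨c, rfl⟩ : z ∈ LinearMap.range (boundary S ℤ 1) := hzr
    exact ⟨c ∘ f, funext fun e => (happ c e).symm⟩
  · rintro ⟨c, rfl⟩
    refine ⟨⟨boundary S ℤ 1 (c ∘ f.symm), boundary_one_mem_ker hS _⟩, ⟨_, rfl⟩, ?_⟩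
    refine funext fun e => (happ _ e).trans ?_
    simp [Function.comp_assoc]

/-- The squared order of the first homology of a complex with complete 1-skeleton and
`C(n-1, 2)` triangles is the determinant of its reduced up-Laplacian. -/
theorem natCard_H1_sq (b : Fin n) (hS : ∀ σ : Finset (Fin n), σ.card = 2 → σ ∈ S.faces)
    (hcard : Fintype.card (Face S 2) = (n - 1).choose 2) {A : Finset (Tri n)}
    (hA : ∀ t : Tri n, t ∈ A ↔ t.1 ∈ S.faces) :
    (Nat.card (H1 S ℤ) : ℝ) ^ 2 =
      (gram (rowBoundary ⊥ b ℝ) fun t => if t ∈ A then 1 else 0).det := by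
  have f : Row ⊥ b ≃ Face S 2 := Fintype.equivOfCardEq (by rw [card_row_bot, hcard])
  set M : Matrix (Row ⊥ b) (Row ⊥ b) ℤ := Matrix.of fun e e' => incidence e.1 (f e').1 with hM
  have h1 : gram (rowBoundary ⊥ b ℝ) (fun t => if t ∈ A then 1 else 0) =
      (M * Mᵀ).map (Int.castRingHom ℝ) := by
    ext e e'
    simp only [gram_apply, rowBoundary, hM, Matrix.map_apply, Matrix.mul_apply,
      Matrix.transpose_apply, Matrix.of_apply, Int.coe_castRingHom, Int.cast_sum, Int.cast_mul]
    rw [Equiv.sum_comp f fun t : Face S 2 => (incidence e.1 t.1 : ℝ) * (incidence e'.1 t.1 : ℝ)]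
    symm
    refine Fintype.sum_of_injective (fun t : Face S 2 => (⟨t.1, t.2.2⟩ : Tri n)) ?_ _ _ ?_ ?_
    · exact fun t t' h => Subtype.ext (congrArg (fun s : Tri n => s.1) h)
    · intro t ht
      have : t ∉ A := fun h => ht ⟨⟨t.1, (hA t).1 h, t.2⟩, rfl⟩
      simp [this]
    · intro t
      simp [(hA ⟨t.1, t.2.2⟩).2 t.2.1]
  rw [natCard_H1_eq b hS f, h1]
  change _ = ((Int.castRingHom ℝ).mapMatrix (M * Mᵀ)).det
  rw [← RingHom.map_det, Matrix.det_mul, Matrix.det_transpose, ← sq]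
  simp [Nat.cast_natAbs, hM]

end Homology

/-! ### The law of the hypertree in terms of triangle sets -/

section Law

open Finset Matrix

variable {n : ℕ}

open Classical in
/-- The triangular faces of a complex. -/
def triangles (S : AbstractSimplicialComplex (Fin n)) : Finset (Tri n) :=
  univ.filter fun t => t.1 ∈ S.faces

theorem mem_triangles {S : AbstractSimplicialComplex (Fin n)} {t : Tri n} :
    t ∈ triangles S ↔ t.1 ∈ S.faces := by
  simp [triangles]

/-- The squared maximal minor of the reduced boundary matrix with columns in `A`. -/
def weight (b : Fin n) (A : Finset (Tri n)) : ℝ :=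
  (gram (rowBoundary ⊥ b ℝ) fun t => if t ∈ A then 1 else 0).det

theorem weight_nonneg (b : Fin n) (A : Finset (Tri n)) : 0 ≤ weight b A :=
  det_gram_indicator_nonneg _ A

/-- The complex with complete 1-skeleton and triangles `A`. -/
def complexOf (A : Finset (Tri n)) : AbstractSimplicialComplex (Fin n) where
  faces := {σ | σ.Nonempty ∧ (σ.card ≤ 2 ∨ ∃ h : σ.card = 3, (⟨σ, h⟩ : Tri n) ∈ A)}
  isRelLowerSet_faces := by
    rintro σ ⟨hσ, h⟩
    refine ⟨hσ, fun τ hτ hne => ⟨hne, ?_⟩⟩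
    have hle := Finset.card_le_card hτ
    rcases h with h | ⟨h, hA⟩
    · exact Or.inl (hle.trans h)
    · by_cases h3 : τ.card = 3
      · have : τ = σ := Finset.eq_of_subset_of_card_le hτ (by omega)
        subst this
        exact Or.inr ⟨h, hA⟩
      · exact Or.inl (by omega)
  singleton_mem v := ⟨Finset.singleton_nonempty v, Or.inl (by simp)⟩

theorem mem_faces_complexOf {A : Finset (Tri n)} {σ : Finset (Fin n)} :
    σ ∈ (complexOf A).faces ↔
      σ.Nonempty ∧ (σ.card ≤ 2 ∨ ∃ h : σ.card = 3, (⟨σ, h⟩ : Tri n) ∈ A) := Iff.rfl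

theorem triangles_complexOf (A : Finset (Tri n)) : triangles (complexOf A) = A := by
  ext t
  rw [mem_triangles, mem_faces_complexOf]
  constructor
  · rintro ⟨-, h | ⟨_, h⟩⟩
    · have := t.2; omega
    · exact h
  · intro h
    exact ⟨Finset.card_pos.1 (by rw [t.2]; norm_num), Or.inr ⟨t.2, h⟩⟩

theorem card_face_two (S : AbstractSimplicialComplex (Fin n)) :
    Fintype.card (Face S 2) = (triangles S).card := by
  rw [← Fintype.card_coe]
  exact Fintype.card_congr
    { toFun := fun t => ⟨⟨t.1, t.2.2⟩, mem_triangles.2 t.2.1⟩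
      invFun := fun t => ⟨t.1.1, mem_triangles.1 t.2, t.1.2⟩
      left_inv := fun _ => rfl
      right_inv := fun _ => rfl }

theorem triangles_injective :
    Function.Injective fun S : Hypertree n => triangles S.1 := by
  intro S T h
  refine Subtype.ext (AbstractSimplicialComplex.ext (Set.ext fun σ => ?_))
  by_cases h3 : σ.card = 3
  · have := congrArg (fun A : Finset (Tri n) => (⟨σ, h3⟩ : Tri n) ∈ A) h
    simpa [mem_triangles] using this
  by_cases h2 : σ.card = 2
  · exact iff_of_true (S.2.complete σ h2) (T.2.complete σ h2)
  by_cases h1 : σ.card = 1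
  · obtain ⟨v, rfl⟩ := Finset.card_eq_one.1 h1
    exact iff_of_true (singleton_mem_faces _ v) (singleton_mem_faces _ v)
  · have hno : ∀ U : Hypertree n, σ ∉ U.1.faces := by
      intro U hU
      have hle := U.2.dim_le σ hU
      have hpos := Finset.card_pos.2 (U.1.isRelLowerSet_faces hU).1
      omega
    exact iff_of_false (hno S) (hno T)

theorem natCard_H1_sq_eq_weight (b : Fin n) (S : Hypertree n) :
    (Nat.card (H1 S.1 ℤ) : ℝ) ^ 2 = weight b (triangles S.1) :=
  natCard_H1_sq b S.2.complete S.2.card_triangles fun _ => mem_triangles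

theorem isHypertree_complexOf (b : Fin n) {A : Finset (Tri n)} (hA : A.card = (n - 1).choose 2)
    (hw : weight b A ≠ 0) : IsHypertree (complexOf A) := by
  have hcomplete : ∀ σ : Finset (Fin n), σ.card = 2 → σ ∈ (complexOf A).faces := fun σ hσ =>
    ⟨Finset.card_pos.1 (by omega), Or.inl hσ.le⟩
  have hcard : Fintype.card (Face (complexOf A) 2) = (n - 1).choose 2 := by
    rw [card_face_two, triangles_complexOf, hA]
  refine ⟨?_, hcomplete, hcard, ?_⟩
  · rintro σ ⟨-, h | ⟨h, -⟩⟩ <;> omega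
  -- `Nat.card` is 0 on infinite types, so a nonzero minor forces finite homology.
  · refine Nat.finite_of_card_ne_zero fun h0 => hw ?_
    have h := natCard_H1_sq b hcomplete hcard (A := A) fun t => by
      rw [← mem_triangles, triangles_complexOf]
    rw [h0] at h
    simpa [weight] using h.symm

instance : MeasurableSingletonClass (Hypertree n) := ⟨fun _ => trivial⟩

instance : Fintype (Hypertree n) := Fintype.ofFinite _

theorem integral_law [NeZero n] (f : Hypertree n → ℝ) :
    ∫ S, f S ∂(law n) =
      ∑ S, (Nat.card (H1 S.1 ℤ) : ℝ) ^ 2 / (n : ℝ) ^ ((n - 2).choose 2) * f S := by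
  have hn : (n : ℝ≥0∞) ≠ 0 := by exact_mod_cast NeZero.ne n
  have hc : ∀ S : Hypertree n,
      (Nat.card (H1 S.1 ℤ) : ℝ≥0∞) ^ 2 / (n : ℝ≥0∞) ^ ((n - 2).choose 2) ≠ ∞ := fun S =>
    ENNReal.div_ne_top (by simp) (pow_ne_zero _ hn)
  unfold law
  rw [Measure.sum_fintype, integral_finsetSum_measure]
  · refine Finset.sum_congr rfl fun S _ => ?_
    rw [integral_smul_measure, integral_dirac, smul_eq_mul]
    simp [ENNReal.toReal_div]
  · intro S _
    exact (integrable_dirac (by simp)).smul_measure (hc S)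

/-- Expectations of functions of the triangles of the determinantal hypertree. -/
theorem integral_law_triangles (b : Fin n) (f : Finset (Tri n) → ℝ) :
    ∫ S, f (triangles S.1) ∂(law n) =
      (∑ A ∈ powersetCard ((n - 1).choose 2) univ, weight b A * f A) /
        (n : ℝ) ^ ((n - 2).choose 2) := by
  have : NeZero n := ⟨by have := b.2; omega⟩
  rw [integral_law, Finset.sum_div]
  refine Finset.sum_of_injOn (fun S : Hypertree n => triangles S.1)
    (fun S _ T _ h => triangles_injective h) ?_ ?_ ?_
  · intro S _
    simp only [Finset.mem_coe, mem_powersetCard]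
    exact ⟨subset_univ _, by rw [← card_face_two, S.2.card_triangles]⟩
  · intro A hA hno
    -- Triangle sets that do not come from a hypertree have weight zero, so the sum can run over all
    -- sets of the right size.
    by_cases hw : weight b A = 0
    · simp [hw]
    · refine absurd ?_ hno
      exact ⟨⟨complexOf A, isHypertree_complexOf b (mem_powersetCard.1 hA).2 hw⟩, by simp,
        triangles_complexOf A⟩
  · intro S _
    rw [natCard_H1_sq_eq_weight b S]
    ring

end Law

/-! ### Cocycles as parity conditions, and moments as sums of determinants -/

section Cocycle

open Finset Matrix

variable {n : ℕ}

open Classical in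
/-- The triangle `t` has an even number of edges of `G`. -/
def EvenOn (G : SimpleGraph (Fin n)) (t : Finset (Fin n)) : Prop :=
  ∀ u x y, u ≠ x → u ≠ y → x ≠ y → t = {u, x, y} →
    (if G.Adj u x then 1 else 0) + (if G.Adj u y then 1 else 0) +
      (if G.Adj x y then 1 else 0) = (0 : ZMod 2)

open Classical in
-- Modulo 2 every sign is 1, so the coboundary at a triangle just counts its edges in `G`.
theorem coboundary_graphCochain {S : AbstractSimplicialComplex (Fin n)}
    (hS : ∀ σ : Finset (Fin n), σ.card = 2 → σ ∈ S.faces) (G : SimpleGraph (Fin n))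
    {u x y : Fin n} (hux : u ≠ x) (huy : u ≠ y) (hxy : x ≠ y) (t : Face S 2)
    (ht : t.1 = {u, x, y}) :
    coboundary S (ZMod 2) 1 (graphCochain S G) t =
      (if G.Adj u x then 1 else 0) + (if G.Adj u y then 1 else 0) +
        (if G.Adj x y then 1 else 0) := by
  have happ : coboundary S (ZMod 2) 1 (graphCochain S G) t =
      ∑ e : Face S 1, (incidence e.1 t.1 : ZMod 2) * (if IsEdge G e.1 then 1 else 0) := by
    simp only [coboundary, boundaryMatrix, mulVecLin_apply, mulVec, dotProduct,
      Matrix.transpose_apply, graphCochain]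
    refine Finset.sum_congr rfl fun e _ => ?_
    congr 1
    exact if_congr Iff.rfl rfl rfl
  have hsg : ∀ a b : Fin n, (sg a b : ZMod 2) = 1 := by
    intro a b; unfold sg; split_ifs <;> decide
  have hne : ({u, x} : Finset (Fin n)) ≠ {u, y} := pair_ne_pair hxy
  have hne2 : ({u, x} : Finset (Fin n)) ≠ {x, y} := by
    rw [Finset.pair_comm u x]; exact pair_ne_pair huy
  have hne3 : ({u, y} : Finset (Fin n)) ≠ {x, y} := by
    rw [Finset.pair_comm u y, Finset.pair_comm x y]; exact pair_ne_pair hux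
  let e₁ : Face S 1 := ⟨{u, x}, hS _ (card_pair hux), card_pair hux⟩
  let e₂ : Face S 1 := ⟨{u, y}, hS _ (card_pair huy), card_pair huy⟩
  let e₃ : Face S 1 := ⟨{x, y}, hS _ (card_pair hxy), card_pair hxy⟩
  rw [happ, ← Finset.sum_subset (Finset.subset_univ ({e₁, e₂, e₃} : Finset (Face S 1)))]
  · rw [Finset.sum_insert, Finset.sum_insert, Finset.sum_singleton]
    · have h3 : ({u, x, y} : Finset (Fin n)) = {x, y, u} := by ext; simp; tauto
      simp only [e₁, e₂, e₃, ht, isEdge_pair]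
      rw [incidence_triple hux huy hxy, incidence_triple' hux huy hxy, h3,
        incidence_triple hxy hux.symm huy.symm]
      simp only [Int.cast_mul, hsg, one_mul]
      ring
    · simpa [e₂, e₃] using hne3
    · simpa [e₁, e₂, e₃] using ⟨hne, hne2⟩
  · intro e _ he
    refine mul_eq_zero_of_left ?_ _
    by_contra h0
    have h0 : incidence e.1 t.1 ≠ 0 := fun h => h0 (by rw [h]; simp)
    obtain ⟨z, hz, hzt⟩ := exists_eq_insert_of_incidence_ne_zero h0
    have hez : e.1 = t.1.erase z := by rw [hzt, Finset.erase_insert hz]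
    have hzm : z ∈ ({u, x, y} : Finset (Fin n)) := by rw [← ht, hzt]; simp
    refine he ?_
    simp only [Finset.mem_insert, Finset.mem_singleton] at hzm ⊢
    rcases hzm with rfl | rfl | rfl
    · refine Or.inr (Or.inr (Subtype.ext ?_))
      rw [hez, ht]; ext w; simp [e₃]; grind
    · refine Or.inr (Or.inl (Subtype.ext ?_))
      rw [hez, ht]; ext w; simp [e₂]; grind
    · refine Or.inl (Subtype.ext ?_)
      rw [hez, ht]; ext w; simp [e₁]; grind

theorem graphCochain_mem_Z1_iff (S : Hypertree n) (G : SimpleGraph (Fin n)) :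
    graphCochain S.1 G ∈ Z1 S.1 (ZMod 2) ↔ ∀ t ∈ triangles S.1, EvenOn G t.1 := by
  constructor
  · intro h t ht u x y hux huy hxy htt
    have h1 := congrFun (LinearMap.mem_ker.1 h) ⟨t.1, mem_triangles.1 ht, t.2⟩
    rwa [coboundary_graphCochain S.2.complete G hux huy hxy _ htt] at h1
  · intro h
    refine LinearMap.mem_ker.2 (funext fun t => ?_)
    obtain ⟨u, x, y, hux, huy, hxy, ht⟩ := Finset.card_eq_three.1 t.2.2
    rw [coboundary_graphCochain S.2.complete G hux huy hxy t ht]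
    exact h ⟨t.1, t.2.2⟩ (mem_triangles.2 t.2.1) u x y hux huy hxy ht

open Classical in
/-- The finset of graphs formed by `h` disjoint 5-cycles. -/
def fiveCycleFinset (n h : ℕ) : Finset (SimpleGraph (Fin n)) :=
  univ.filter (· ∈ fiveCycleGraphs n h)

open Classical in
theorem X_eq_sum (h : ℕ) (S : Hypertree n) :
    (X h S : ℝ) = ∑ G ∈ fiveCycleFinset n h,
      if ∀ t ∈ triangles S.1, EvenOn G t.1 then 1 else 0 := by
  unfold X
  rw [Finset.sum_boole, ← Set.ncard_coe_finset]
  congr 2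
  ext G
  simp [fiveCycleFinset, graphCochain_mem_Z1_iff]

open Classical in
/-- The expected value of `X` as a sum of determinants of reduced up-Laplacians. -/
theorem integral_X (h : ℕ) (b : SimpleGraph (Fin n) → Fin n) :
    ∫ S, (X h S : ℝ) ∂(law n) = ∑ G ∈ fiveCycleFinset n h,
      weight (b G) (univ.filter fun t => EvenOn G t.1) / (n : ℝ) ^ ((n - 2).choose 2) := by
  have : NeZero n := ⟨by have := (b ⊥).2; omega⟩
  have h1 : ∫ S, (X h S : ℝ) ∂(law n) = ∑ G ∈ fiveCycleFinset n h,
      ∫ S, (if ∀ t ∈ triangles S.1, EvenOn G t.1 then (1 : ℝ) else 0) ∂(law n) := by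
    simp_rw [X_eq_sum, integral_law, Finset.mul_sum]
    rw [Finset.sum_comm]
  rw [h1]
  refine Finset.sum_congr rfl fun G _ => ?_
  -- The expectation formula holds for every base vertex, which may therefore depend on the graph.
  rw [integral_law_triangles (b G) fun A => if ∀ t ∈ A, EvenOn G t.1 then (1 : ℝ) else 0]
  congr 1
  have h2 := sum_det_gram_indicator (rowBoundary ⊥ (b G) ℝ) (univ.filter fun t => EvenOn G t.1)
  unfold weight
  rw [← h2, card_row_bot]
  simp only [mul_ite, mul_one, mul_zero]
  rw [← Finset.sum_filter]
  refine Finset.sum_congr ?_ fun _ _ => rfl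
  ext A
  simp only [mem_filter, mem_powersetCard, true_and, Finset.subset_iff, mem_univ]
  tauto

open Classical in
/-- The second moment of `X` as a sum over pairs of graphs. -/
theorem integral_X_sq (h : ℕ) (b : SimpleGraph (Fin n) → SimpleGraph (Fin n) → Fin n) :
    ∫ S, (X h S : ℝ) ^ 2 ∂(law n) =
      ∑ G₁ ∈ fiveCycleFinset n h, ∑ G₂ ∈ fiveCycleFinset n h,
        (∑ A ∈ powersetCard ((n - 1).choose 2) univ, weight (b G₁ G₂) A *
          (if ∀ t ∈ A, EvenOn G₁ t.1 ∧ EvenOn G₂ t.1 then 1 else 0)) /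
            (n : ℝ) ^ ((n - 2).choose 2) := by
  have : NeZero n := ⟨by have := (b ⊥ ⊥).2; omega⟩
  have h1 : ∫ S, (X h S : ℝ) ^ 2 ∂(law n) =
      ∑ G₁ ∈ fiveCycleFinset n h, ∑ G₂ ∈ fiveCycleFinset n h,
        ∫ S, (if ∀ t ∈ triangles S.1, EvenOn G₁ t.1 ∧ EvenOn G₂ t.1 then (1 : ℝ) else 0)
          ∂(law n) := by
    simp_rw [X_eq_sum, integral_law, sq, Finset.sum_mul_sum, Finset.mul_sum]
    rw [Finset.sum_comm]
    refine Finset.sum_congr rfl fun G₁ _ => ?_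
    rw [Finset.sum_comm]
    refine Finset.sum_congr rfl fun G₂ _ => Finset.sum_congr rfl fun S _ => ?_
    congr 1
    simp only [forall_and, ite_and, mul_ite, mul_one, mul_zero]
    split_ifs <;> rfl
  rw [h1]
  refine Finset.sum_congr rfl fun G₁ _ => Finset.sum_congr rfl fun G₂ _ => ?_
  exact integral_law_triangles (b G₁ G₂)
    fun A => if ∀ t ∈ A, EvenOn G₁ t.1 ∧ EvenOn G₂ t.1 then (1 : ℝ) else 0

end Cocycle

/-! ### Lower bound for the flag determinant of a sparse graph -/

section Laplacian

open Finset Matrix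

variable {n : ℕ}

theorem abs_incidence_le_one (τ σ : Finset (Fin n)) : |(incidence τ σ : ℝ)| ≤ 1 := by
  by_cases h : incidence τ σ = 0
  · simp [h]
  · have h1 : (incidence τ σ : ℝ) * (incidence τ σ : ℝ) = 1 := by
      exact_mod_cast incidence_mul_self h
    rw [← abs_mul_abs_self] at h1
    nlinarith [abs_nonneg (incidence τ σ : ℝ)]

theorem sum_abs_rowBoundary_le (G : SimpleGraph (Fin n)) (b : Fin n) (t : Tri n) :
    ∑ e, |rowBoundary G b ℝ e t| ≤ 3 := by
  have h1 : ∑ e, |rowBoundary G b ℝ e t| ≤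
      ∑ e : Row G b, if e.1 ∈ powersetCard 2 t.1 then (1 : ℝ) else 0 := by
    refine Finset.sum_le_sum fun e _ => ?_
    split_ifs with h
    · exact abs_incidence_le_one _ _
    · have : incidence e.1 t.1 = 0 := by
        by_contra h0
        exact h (mem_powersetCard.2 ⟨subset_of_incidence_ne_zero h0, e.2.1⟩)
      simp [rowBoundary, this]
  refine h1.trans ?_
  rw [Finset.sum_boole]
  have h2 : (univ.filter fun e : Row G b => e.1 ∈ powersetCard 2 t.1).card ≤
      (powersetCard 2 t.1).card :=
    Finset.card_le_card_of_injOn Subtype.val (fun e he => (mem_filter.1 he).2)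
      (Subtype.val_injective.injOn)
  rw [card_powersetCard, t.2] at h2
  exact_mod_cast h2

/-- The boundary matrix from the edges in `Row G b` to the vertices. -/
def rowDown (G : SimpleGraph (Fin n)) (b : Fin n) : Matrix (Fin n) (Row G b) ℝ :=
  fun v e => (incidence {v} e.1 : ℝ)

open Classical in
/-- The triangles that contain no edge of `G`. -/
def flagTri (G : SimpleGraph (Fin n)) : Finset (Tri n) :=
  univ.filter fun t => ∀ e ⊆ t.1, ¬ IsEdge G e

theorem mem_flagTri {G : SimpleGraph (Fin n)} {t : Tri n} :
    t ∈ flagTri G ↔ ∀ e ⊆ t.1, ¬ IsEdge G e := by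
  simp [flagTri]

/-- The reduced up-Laplacian of the flag complex of the complement of `G`. -/
def flagLap (G : SimpleGraph (Fin n)) (b : Fin n) : Matrix (Row G b) (Row G b) ℝ :=
  gram (rowBoundary G b ℝ) fun t => if t ∈ flagTri G then 1 else 0

/-- The contribution of the triangles that contain an edge of `G`. -/
def badLap (G : SimpleGraph (Fin n)) (b : Fin n) : Matrix (Row G b) (Row G b) ℝ :=
  gram (rowBoundary G b ℝ) fun t => if t ∈ flagTri G then 0 else 1

theorem incidence_insert_ne_zero {e : Finset (Fin n)} {x : Fin n} (hx : x ∉ e) :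
    incidence e (insert x e) ≠ 0 := by
  rw [incidence_insert hx]
  refine Finset.prod_ne_zero_iff.2 fun y _ => ?_
  unfold sg; split_ifs <;> norm_num

theorem sum_row_incidence_of_notMem {G : SimpleGraph (Fin n)} {b : Fin n} (v : Fin n) {t : Tri n}
    (ht : t ∈ flagTri G) (hb : b ∉ t.1) :
    ∑ e : Row G b, incidence {v} e.1 * incidence e.1 t.1 = 0 :=
  sum_incidence_mul_incidence (fun e : Row G b => e.1) Subtype.val_injective v t.2
    fun e he h2 => ⟨⟨e, h2, fun h => hb (he h), mem_flagTri.1 ht e he⟩, rfl⟩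

theorem sum_row_incidence_insert {G : SimpleGraph (Fin n)} {b : Fin n} (v : Fin n)
    (e : Row G b) :
    ∑ e' : Row G b, incidence {v} e'.1 * incidence e'.1 (insert b e.1) =
      incidence {v} e.1 * incidence e.1 (insert b e.1) := by
  refine Fintype.sum_eq_single e fun e' he' => mul_eq_zero_of_right _ ?_
  by_contra h
  refine he' (Subtype.ext (Finset.eq_of_subset_of_card_le ?_ ?_))
  · intro x hx
    refine (Finset.mem_insert.1 (subset_of_incidence_ne_zero h hx)).resolve_left ?_
    rintro rfl
    exact e'.2.2.1 hx
  · rw [e.2.1, e'.2.1]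

theorem insert_base_mem_flagTri {G : SimpleGraph (Fin n)} {b : Fin n} (hb : ∀ x, ¬ G.Adj b x)
    (e : Row G b) (h : (insert b e.1).card = 3) : (⟨insert b e.1, h⟩ : Tri n) ∈ flagTri G := by
  refine mem_flagTri.2 fun e' he' hG => ?_
  have hbe : b ∉ e' := by
    intro hbe
    obtain ⟨x, -, rfl⟩ := exists_eq_pair hG.card_eq_two hbe
    exact hb x (isEdge_pair.1 hG)
  have hsub : e' ⊆ e.1 := fun x hx =>
    (Finset.mem_insert.1 (he' hx)).resolve_left (by rintro rfl; exact hbe hx)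
  have : e' = e.1 := Finset.eq_of_subset_of_card_le hsub (by rw [e.2.1, hG.card_eq_two])
  exact e.2.2.2 (this ▸ hG)

/-- A flag triangle avoiding `b` has all its edges among the rows and contributes zero, a boundary
having no boundary. The only other triangle incident to the row `e` is `insert b e`: it is flag
because `b` is isolated, `e` is its only row edge, and its sign squares to 1. -/
theorem flagLap_mul_rowDown {G : SimpleGraph (Fin n)} {b : Fin n} (hb : ∀ x, ¬ G.Adj b x) :
    flagLap G b * (rowDown G b)ᵀ = (rowDown G b)ᵀ := by
  ext e v
  have h3 : (insert b e.1).card = 3 := by rw [Finset.card_insert_of_notMem e.2.2.1, e.2.1]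
  have h1 : (flagLap G b * (rowDown G b)ᵀ) e v = ∑ t : Tri n, (incidence e.1 t.1 : ℝ) *
      (if t ∈ flagTri G then 1 else 0) *
        ((∑ e' : Row G b, incidence {v} e'.1 * incidence e'.1 t.1 : ℤ) : ℝ) := by
    simp only [flagLap, Matrix.mul_apply, gram_apply, Matrix.transpose_apply, rowDown, rowBoundary,
      Finset.sum_mul]
    rw [Finset.sum_comm]
    refine Finset.sum_congr rfl fun t _ => ?_
    push_cast
    rw [Finset.mul_sum]
    exact Finset.sum_congr rfl fun e' _ => by ring
  rw [h1, Fintype.sum_eq_single ⟨insert b e.1, h3⟩]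
  · rw [if_pos (insert_base_mem_flagTri hb e h3), sum_row_incidence_insert]
    have := incidence_mul_self (incidence_insert_ne_zero e.2.2.1)
    have : (incidence e.1 (insert b e.1) : ℝ) * incidence e.1 (insert b e.1) = 1 := by
      exact_mod_cast this
    simp only [Matrix.transpose_apply, rowDown]
    push_cast
    linear_combination (incidence {v} e.1 : ℝ) * this
  · intro t ht
    by_cases hbt : b ∈ t.1
    · have : incidence e.1 t.1 = 0 := by
        by_contra h0
        refine ht (Subtype.ext (Finset.eq_of_subset_of_card_le ?_ ?_).symm)
        · exact Finset.insert_subset hbt (subset_of_incidence_ne_zero h0)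
        · rw [t.2, h3]
      simp [this]
    · by_cases hf : t ∈ flagTri G
      · rw [sum_row_incidence_of_notMem v hf hbt]; simp
      · simp [hf]

/-- The flag and remaining triangles together give the full up-Laplacian, so this is the identity
for the complete complex restricted to `Row G b`. -/
theorem flagLap_add_badLap (G : SimpleGraph (Fin n)) (b : Fin n) :
    flagLap G b + badLap G b + (rowDown G b)ᵀ * rowDown G b =
      (n : ℝ) • (1 : Matrix (Row G b) (Row G b) ℝ) := by
  ext e e'
  have h := sum_incidence_add_sum_incidence e.2.1 e'.2.1
  have h2 : (∑ t : Tri n, (incidence e.1 t.1 : ℝ) * incidence e'.1 t.1) +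
      ∑ v, (incidence {v} e.1 : ℝ) * incidence {v} e'.1 = if e.1 = e'.1 then (n : ℝ) else 0 := by
    exact_mod_cast h
  simp only [Matrix.add_apply, flagLap, badLap, gram_apply, Matrix.mul_apply,
    Matrix.transpose_apply, rowDown, rowBoundary, Matrix.smul_apply, Matrix.one_apply, smul_eq_mul,
    mul_ite, mul_one, mul_zero, Subtype.ext_iff]
  rw [← h2, ← Finset.sum_add_distrib]
  congr 1
  refine Finset.sum_congr rfl fun t _ => ?_
  split_ifs <;> ring

/-- The determinant of the reduced Laplacian on the vertices of the complement of `G`. -/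
def treeDet (G : SimpleGraph (Fin n)) (b : Fin n) : ℝ :=
  (1 + rowDown G b * (rowDown G b)ᵀ).det

/-- The left matrix is `flagLap` + DᵀD with D = `rowDown`, and `flagLap` fixes Dᵀ, so it factors as
`flagLap` · (1 + DᵀD). Sylvester's identity moves the second determinant from edges to vertices. -/
theorem det_smul_one_sub_badLap {G : SimpleGraph (Fin n)} {b : Fin n} (hb : ∀ x, ¬ G.Adj b x) :
    ((n : ℝ) • (1 : Matrix (Row G b) (Row G b) ℝ) - badLap G b).det =
      (flagLap G b).det * treeDet G b := by
  have h : (n : ℝ) • (1 : Matrix (Row G b) (Row G b) ℝ) - badLap G b =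
      flagLap G b * (1 + (rowDown G b)ᵀ * rowDown G b) := by
    rw [Matrix.mul_add, Matrix.mul_one, ← Matrix.mul_assoc, flagLap_mul_rowDown hb,
      ← flagLap_add_badLap]
    abel
  rw [h, Matrix.det_mul, Matrix.det_one_add_mul_comm]
  rfl

theorem sum_row_eq_sum_ite (G : SimpleGraph (Fin n)) (b : Fin n) (f : Finset (Fin n) → ℝ) :
    ∑ e : Row G b, f e.1 = ∑ e : Row ⊥ b, if IsEdge G e.1 then 0 else f e.1 := by
  refine Fintype.sum_of_injective
    (fun e : Row G b => (⟨e.1, e.2.1, e.2.2.1, not_isEdge_bot _⟩ : Row ⊥ b)) ?_ _ _ ?_ ?_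
  · exact fun e e' h => Subtype.ext (congrArg (fun s : Row ⊥ b => s.1) h)
  · intro e he
    refine if_pos ?_
    by_contra h
    exact he ⟨⟨e.1, e.2.1, e.2.2.1, h⟩, rfl⟩
  · intro e
    exact (if_neg e.2.2.2).symm

/-- Deleting edges only lowers weights: 1 + DDᵀ is the Gram matrix of the columns of [1 | D], with
weight 0 on the edges of the graph. -/
theorem treeDet_le_treeDet_bot (G : SimpleGraph (Fin n)) (b : Fin n) :
    treeDet G b ≤ treeDet ⊥ b := by
  have key : ∀ H : SimpleGraph (Fin n), treeDet H b =
      (gram (Matrix.fromCols (1 : Matrix (Fin n) (Fin n) ℝ) (rowDown ⊥ b))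
        (Sum.elim (fun _ => 1) fun e => if IsEdge H e.1 then 0 else 1)).det := by
    intro H
    unfold treeDet
    congr 1
    ext u v
    rw [gram_apply, Fintype.sum_sum_type, Matrix.add_apply]
    congr 1
    · simp [Matrix.one_apply]
    · simp only [Matrix.mul_apply, Matrix.transpose_apply, rowDown, Matrix.fromCols_apply_inr,
        Sum.elim_inr]
      rw [sum_row_eq_sum_ite H b fun e => (incidence {u} e : ℝ) * incidence {v} e]
      refine Finset.sum_congr rfl fun e _ => ?_
      split_ifs <;> ring
  rw [key G, key ⊥]
  refine det_gram_mono _ ?_ ?_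
  · rintro (t | t)
    · simp
    · simp only [Sum.elim_inr]; split_ifs <;> norm_num
  · rintro (t | t)
    · simp
    · simp only [Sum.elim_inr, not_isEdge_bot, if_false]; split_ifs <;> norm_num

theorem rowDown_bot_mul_transpose_apply {b u v : Fin n} (hu : u ≠ b) (hv : v ≠ b) :
    (rowDown ⊥ b * (rowDown ⊥ b)ᵀ) u v = if u = v then (n : ℝ) - 2 else -1 := by
  have h1 : (rowDown ⊥ b * (rowDown ⊥ b)ᵀ) u v =
      ((∑ e : Row ⊥ b, incidence {u} e.1 * incidence {v} e.1 : ℤ) : ℝ) := by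
    simp [Matrix.mul_apply, rowDown]
  rw [h1]
  split_ifs with huv
  · subst huv
    have h := Fintype.sum_of_injective
      (fun x : {x // x ∉ ({u, b} : Finset (Fin n))} => (⟨{u, x.1}, by
        have hx := x.2
        simp only [mem_insert, mem_singleton, not_or] at hx
        refine ⟨card_pair (Ne.symm hx.1), ?_, not_isEdge_bot _⟩
        simp only [mem_insert, mem_singleton, not_or]
        exact ⟨hu.symm, Ne.symm hx.2⟩⟩ : Row ⊥ b))
      ?_ (fun _ => (1 : ℤ)) (fun e => incidence {u} e.1 * incidence {u} e.1) ?_ ?_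
    · rw [← h]
      have hc : Fintype.card {x // x ∉ ({u, b} : Finset (Fin n))} = n - 2 := by
        rw [Fintype.card_subtype_compl, Fintype.card_fin, Fintype.card_coe, card_pair hu]
      have hn : 2 ≤ n := by
        have := Finset.card_le_univ ({u, b} : Finset (Fin n))
        rwa [card_pair hu, Fintype.card_fin] at this
      simp only [Finset.sum_const, Finset.card_univ, hc, nsmul_eq_mul, mul_one]
      push_cast [hn]
      ring
    · intro x y hxy
      by_contra hne
      exact pair_ne_pair (u := u) (fun h => hne (Subtype.ext h)) (congrArg Subtype.val hxy)
    · intro e he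
      by_contra hne
      have hm := subset_of_incidence_ne_zero (left_ne_zero_of_mul hne) (mem_singleton_self u)
      obtain ⟨x, hux, hx⟩ := exists_eq_pair e.2.1 hm
      refine he ⟨⟨x, ?_⟩, Subtype.ext hx.symm⟩
      simp only [mem_insert, mem_singleton, not_or]
      refine ⟨hux.symm, ?_⟩
      rintro rfl
      exact e.2.2.1 (by rw [hx]; simp)
    · intro x
      have hx := x.2
      simp only [mem_insert, mem_singleton, not_or] at hx
      rw [incidence_pair (Ne.symm hx.1), sg_mul_self]
  · rw [Fintype.sum_eq_single (⟨{u, v}, card_pair huv, by simp [hu.symm, hv.symm],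
      not_isEdge_bot _⟩ : Row ⊥ b)]
    · simp only
      rw [incidence_pair huv, Finset.pair_comm, incidence_pair (Ne.symm huv), sg_swap huv,
        mul_neg, sg_mul_self]
      norm_num
    · intro e he
      by_contra hne
      have h1 := subset_of_incidence_ne_zero (left_ne_zero_of_mul hne) (mem_singleton_self u)
      have h2 := subset_of_incidence_ne_zero (right_ne_zero_of_mul hne) (mem_singleton_self v)
      refine he (Subtype.ext (Finset.eq_of_subset_of_card_le ?_ ?_).symm)
      · intro y hy
        simp only [Finset.mem_insert, Finset.mem_singleton] at hy
        rcases hy with rfl | rfl <;> assumption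
      · rw [e.2.1, card_pair huv]

theorem rowDown_base (G : SimpleGraph (Fin n)) (b : Fin n) (e : Row G b) :
    rowDown G b b e = 0 := by
  have : incidence {b} e.1 = 0 := by
    by_contra h
    exact e.2.2.1 (subset_of_incidence_ne_zero h (by simp))
  simp [rowDown, this]

theorem sum_incidence_singleton {e : Finset (Fin n)} (he : e.card = 2) :
    ∑ v, incidence {v} e = 0 := by
  obtain ⟨x, y, hxy, rfl⟩ := Finset.card_eq_two.1 he
  rw [Fintype.sum_eq_add x y hxy]
  · rw [incidence_pair hxy, Finset.pair_comm x y, incidence_pair hxy.symm, sg_swap hxy]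
    ring
  · rintro z ⟨hzx, hzy⟩
    by_contra hne
    have := subset_of_incidence_ne_zero hne
    simp [hzx, hzy] at this

/-- The Cayley formula for the number of spanning trees. -/
theorem treeDet_bot (b : Fin n) (hn : 2 ≤ n) : treeDet ⊥ b = (n : ℝ) ^ (n - 2) := by
  -- `k` is the indicator column of the vertices other than `b`. It is killed by the transpose of
  -- `rowDown`, so multiplying by 1 + kkᵀ, of determinant n, cancels the off-diagonal entries -1 and
  -- leaves a diagonal matrix of determinant n^(n-1).
  obtain ⟨k, hk⟩ : ∃ k : Matrix (Fin n) Unit ℝ, ∀ v i, k v i = if v = b then 0 else 1 :=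
    ⟨fun v _ => if v = b then 0 else 1, fun _ _ => rfl⟩
  have hDk : (rowDown ⊥ b)ᵀ * k = 0 := by
    ext e i
    have h1 : ((rowDown ⊥ b)ᵀ * k) e i = ∑ v, (incidence {v} e.1 : ℝ) := by
      rw [Matrix.mul_apply]
      refine Finset.sum_congr rfl fun v _ => ?_
      by_cases hv : v = b
      · subst hv
        have := rowDown_base ⊥ v e
        simp only [rowDown] at this
        simp [hk, this]
      · simp [hk, hv, rowDown]
    rw [h1, Matrix.zero_apply]
    exact_mod_cast sum_incidence_singleton e.2.1
  have hprod : (1 + rowDown ⊥ b * (rowDown ⊥ b)ᵀ) * (1 + k * kᵀ) =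
      Matrix.diagonal fun v => if v = b then (1 : ℝ) else n := by
    have h0 : rowDown ⊥ b * (rowDown ⊥ b)ᵀ * (k * kᵀ) = 0 := by
      rw [Matrix.mul_assoc, ← Matrix.mul_assoc (rowDown ⊥ b)ᵀ, hDk, Matrix.zero_mul,
        Matrix.mul_zero]
    rw [Matrix.add_mul, Matrix.one_mul, Matrix.mul_add, h0, Matrix.mul_one, add_zero]
    ext u v
    have hkk : (k * kᵀ) u v = if u = b ∨ v = b then 0 else 1 := by
      simp only [Matrix.mul_apply, hk, Matrix.transpose_apply, Finset.univ_unique, sum_singleton]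
      by_cases h1 : u = b <;> by_cases h2 : v = b <;> simp [h1, h2]
    rw [Matrix.add_apply, Matrix.add_apply, hkk, Matrix.diagonal_apply, Matrix.one_apply]
    by_cases hu : u = b
    · subst hu
      have : (rowDown ⊥ u * (rowDown ⊥ u)ᵀ) u v = 0 := by
        simp [Matrix.mul_apply, rowDown_base]
      rw [this]; simp
    · by_cases hv : v = b
      · subst hv
        have : (rowDown ⊥ v * (rowDown ⊥ v)ᵀ) u v = 0 := by
          simp [Matrix.mul_apply, rowDown_base]
        rw [this]; simp [hu]
      · rw [rowDown_bot_mul_transpose_apply hu hv]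
        by_cases huv : u = v
        · subst huv; simp [hu]; ring
        · simp [huv, hu, hv]
  have hcard : ((univ : Finset (Fin n)).filter fun v => ¬ v = b).card = n - 1 := by
    rw [Finset.filter_not, Finset.filter_eq', if_pos (mem_univ b), Finset.card_sdiff_of_subset
      (Finset.subset_univ _)]
    simp
  have hkdet : (1 + k * kᵀ).det = (n : ℝ) := by
    rw [Matrix.det_one_add_mul_comm, Matrix.det_unique]
    simp only [Matrix.add_apply, Matrix.one_apply_eq, Matrix.mul_apply, Matrix.transpose_apply, hk]
    have : ∀ v : Fin n, (if v = b then (0 : ℝ) else 1) * (if v = b then 0 else 1) =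
        if ¬ v = b then 1 else 0 := by intro v; split_ifs <;> simp
    simp_rw [this]
    rw [Finset.sum_boole, hcard]
    push_cast [show 1 ≤ n by omega]
    ring
  have hdet := congrArg Matrix.det hprod
  rw [Matrix.det_mul, hkdet, Matrix.det_diagonal, Finset.prod_ite, Finset.prod_const_one, one_mul,
    Finset.prod_const, hcard, show n - 1 = n - 2 + 1 by omega, pow_succ] at hdet
  exact mul_right_cancel₀ (by positivity) hdet

theorem badLap_bot (b : Fin n) : badLap ⊥ b = 0 := by
  ext e e'
  have : ∀ t : Tri n, t ∈ flagTri (⊥ : SimpleGraph (Fin n)) := fun t =>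
    mem_flagTri.2 fun e _ => not_isEdge_bot e
  simp [badLap, gram_apply, this]

theorem choose_two_eq (hn : 2 ≤ n) : (n - 1).choose 2 = (n - 2).choose 2 + (n - 2) := by
  obtain ⟨m, rfl⟩ := Nat.exists_eq_add_of_le hn
  have h1 : 2 + m - 1 = m + 1 := by omega
  have h2 : 2 + m - 2 = m := by omega
  rw [h1, h2, Nat.choose_succ_succ' m 1, Nat.choose_one_right]
  ring

/-- The total weight of the hypertrees on `n` vertices. -/
theorem det_flagLap_bot (b : Fin n) (hn : 2 ≤ n) :
    (flagLap ⊥ b).det = (n : ℝ) ^ ((n - 2).choose 2) := by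
  have h := det_smul_one_sub_badLap (G := (⊥ : SimpleGraph (Fin n))) (b := b) fun x hx => hx
  rw [badLap_bot, sub_zero, Matrix.det_smul, Matrix.det_one, mul_one, card_row_bot,
    treeDet_bot b hn, choose_two_eq hn, pow_add] at h
  exact (mul_right_cancel₀ (by positivity) h).symm

theorem badLap_posSemidef (G : SimpleGraph (Fin n)) (b : Fin n) : (badLap G b).PosSemidef :=
  gram_posSemidef _ fun t => by split_ifs <;> norm_num

open Classical in
-- As `e` is not an edge of `G`, an edge of `G` in the triangle `insert x e` must use the new vertex
-- `x`, so `x` lies in `V`.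
theorem card_bad_containing_le {G : SimpleGraph (Fin n)} {b : Fin n} {V : Finset (Fin n)}
    (hV : ∀ x y, G.Adj x y → x ∈ V) (e : Row G b) :
    ((univ : Finset (Tri n)).filter fun t => incidence e.1 t.1 ≠ 0 ∧ t ∉ flagTri G).card ≤
      V.card := by
  refine (Finset.card_le_card_of_injOn (t := V.image fun x => insert x e.1) Subtype.val ?_
    Subtype.val_injective.injOn).trans Finset.card_image_le
  intro t ht
  obtain ⟨h0, hf⟩ := (mem_filter.1 ht).2
  obtain ⟨x, hx, hxt⟩ := exists_eq_insert_of_incidence_ne_zero h0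
  simp only [mem_flagTri, not_forall, not_not] at hf
  obtain ⟨e', he', y, z, hyz, rfl⟩ := hf
  refine Finset.mem_coe.2 (mem_image.2 ⟨x, ?_, hxt.symm⟩)
  have hyt : y ∈ insert x e.1 := hxt ▸ he' (by simp)
  have hzt : z ∈ insert x e.1 := hxt ▸ he' (by simp)
  rcases Finset.mem_insert.1 hyt with rfl | hy
  · exact hV _ _ hyz
  rcases Finset.mem_insert.1 hzt with rfl | hz
  · exact hV _ _ hyz.symm
  · refine absurd ⟨y, z, hyz, ?_⟩ e.2.2.2
    refine (Finset.eq_of_subset_of_card_le ?_ ?_).symm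
    · intro w hw
      simp only [Finset.mem_insert, Finset.mem_singleton] at hw
      rcases hw with rfl | rfl <;> assumption
    · rw [e.2.1, card_pair hyz.ne]

/-- At most |V| bad triangles contain `e`, each with at most three row edges. This feeds the
Gershgorin bound. -/
theorem sum_abs_badLap_le {G : SimpleGraph (Fin n)} {b : Fin n} {V : Finset (Fin n)}
    (hV : ∀ x y, G.Adj x y → x ∈ V) (e : Row G b) : ∑ e', |badLap G b e e'| ≤ 3 * V.card := by
  classical
  calc ∑ e', |badLap G b e e'|
      ≤ ∑ e', ∑ t : Tri n, (if incidence e.1 t.1 ≠ 0 ∧ t ∉ flagTri G then 1 else 0) *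
          |rowBoundary G b ℝ e' t| := by
        refine Finset.sum_le_sum fun e' _ => ?_
        rw [badLap, gram_apply]
        refine (Finset.abs_sum_le_sum_abs _ _).trans (Finset.sum_le_sum fun t _ => ?_)
        rw [abs_mul]
        refine mul_le_mul_of_nonneg_right ?_ (abs_nonneg _)
        rw [abs_mul]
        by_cases h0 : incidence e.1 t.1 = 0
        · simp [rowBoundary, h0]
        · by_cases hf : t ∈ flagTri G
          · simp [hf]
          · simp only [hf, if_false, abs_one, mul_one, h0, ne_eq, not_false_eq_true, and_self,
              if_true]
            exact abs_incidence_le_one _ _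
    _ = ∑ t : Tri n, (if incidence e.1 t.1 ≠ 0 ∧ t ∉ flagTri G then 1 else 0) *
          ∑ e', |rowBoundary G b ℝ e' t| := by
        rw [Finset.sum_comm]
        exact Finset.sum_congr rfl fun t _ => by rw [Finset.mul_sum]
    _ ≤ ∑ t : Tri n, (if incidence e.1 t.1 ≠ 0 ∧ t ∉ flagTri G then 1 else 0) * 3 := by
        refine Finset.sum_le_sum fun t _ => ?_
        refine mul_le_mul_of_nonneg_left (sum_abs_rowBoundary_le G b t) ?_
        split_ifs <;> norm_num
    _ = (((univ : Finset (Tri n)).filter fun t =>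
          incidence e.1 t.1 ≠ 0 ∧ t ∉ flagTri G).card : ℝ) * 3 := by
        rw [← Finset.sum_mul, Finset.sum_boole]
    _ ≤ 3 * V.card := by
        have : (((univ : Finset (Tri n)).filter fun t =>
          incidence e.1 t.1 ≠ 0 ∧ t ∉ flagTri G).card : ℝ) ≤ V.card := by
          exact_mod_cast card_bad_containing_le hV e
        linarith

/-- The set of edges of `G`, as two-element sets of vertices. -/
def edges (G : SimpleGraph (Fin n)) : Finset (Finset (Fin n)) := univ.filter (IsEdge G)

theorem mem_edges {G : SimpleGraph (Fin n)} {e : Finset (Fin n)} : e ∈ edges G ↔ IsEdge G e := by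
  simp [edges]

theorem card_compl_flagTri_le (G : SimpleGraph (Fin n)) :
    (flagTri G)ᶜ.card ≤ (edges G).card * n := by
  classical
  have h := Finset.card_le_card_of_injOn (s := (flagTri G)ᶜ)
    (t := (edges G ×ˢ (univ : Finset (Fin n))).image fun p => insert p.2 p.1) Subtype.val ?_
    Subtype.val_injective.injOn
  · refine h.trans (Finset.card_image_le.trans ?_)
    rw [Finset.card_product, Finset.card_univ, Fintype.card_fin]
  · intro t ht
    have hf : t ∉ flagTri G := by simpa using ht
    simp only [mem_flagTri, not_forall, not_not] at hf
    obtain ⟨e, het, he⟩ := hf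
    have hc : (t.1 \ e).card = 1 := by
      rw [Finset.card_sdiff_of_subset het, t.2, he.card_eq_two]
    obtain ⟨x, hx⟩ := Finset.card_eq_one.1 hc
    refine Finset.mem_coe.2 (mem_image.2 ⟨(e, x), by simp [mem_edges, he], ?_⟩)
    rw [← Finset.sdiff_union_of_subset het, hx]
    rfl

theorem trace_badLap_le (G : SimpleGraph (Fin n)) (b : Fin n) :
    (badLap G b).trace ≤ 3 * ((edges G).card * n) := by
  classical
  have h1 : (badLap G b).trace ≤ ∑ t : Tri n, if t ∈ (flagTri G)ᶜ then (3 : ℝ) else 0 := by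
    simp only [Matrix.trace, Matrix.diag_apply, badLap, gram_apply]
    rw [Finset.sum_comm]
    refine Finset.sum_le_sum fun t _ => ?_
    by_cases hf : t ∈ flagTri G
    · simp [hf]
    · simp only [hf, if_false, mul_one, mem_compl, not_false_eq_true, if_true]
      refine le_trans (Finset.sum_le_sum fun e _ => ?_) (sum_abs_rowBoundary_le G b t)
      rw [← abs_mul_abs_self]
      exact mul_le_of_le_one_left (abs_nonneg _) (abs_incidence_le_one _ _)
  refine h1.trans ?_
  rw [← Finset.sum_filter, Finset.sum_const, nsmul_eq_mul, Finset.filter_mem_eq_inter,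
    Finset.univ_inter]
  have : ((flagTri G)ᶜ.card : ℝ) ≤ (edges G).card * n := by
    exact_mod_cast card_compl_flagTri_le G
  linarith

/-- Lower bound for the weighted number of hypertrees of the flag complex of the complement of a
sparse graph. -/
theorem le_det_flagLap {G : SimpleGraph (Fin n)} {b : Fin n} (hb : ∀ x, ¬ G.Adj b x)
    {V : Finset (Fin n)} (hV : ∀ x y, G.Adj x y → x ∈ V) (hn : 2 ≤ n) (hVn : 6 * V.card ≤ n) :
    (n : ℝ) ^ Fintype.card (Row G b) * Real.exp (-(6 * (edges G).card)) ≤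
      (flagLap G b).det * (n : ℝ) ^ (n - 2) := by
  have hn0 : (0 : ℝ) < n := by exact_mod_cast (by omega : 0 < n)
  have hVn' : 6 * (V.card : ℝ) ≤ n := by exact_mod_cast hVn
  -- The condition 6|V| ≤ n puts the row sums 3|V| below n/2; the trace bound 3n|E(G)| then gives
  -- the exponent 2 · 3|E(G)|.
  have h1 := pow_mul_exp_le_det_smul_one_sub (badLap_posSemidef G b) hn0 fun e =>
    (sum_abs_badLap_le hV e).trans (by linarith)
  rw [det_smul_one_sub_badLap hb] at h1
  have h2 : Real.exp (-(6 * (edges G).card)) ≤ Real.exp (-(2 * (badLap G b).trace / n)) := by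
    rw [Real.exp_le_exp, neg_le_neg_iff, div_le_iff₀ hn0]
    have := trace_badLap_le G b
    linarith
  refine (mul_le_mul_of_nonneg_left h2 (by positivity)).trans (h1.trans ?_)
  refine mul_le_mul_of_nonneg_left ?_ ?_
  · rw [← treeDet_bot b hn]
    exact treeDet_le_treeDet_bot G b
  · exact det_gram_indicator_nonneg _ _

end Laplacian

/-! ### Möbius strips and the probability that one graph is a cocycle -/

section FiveCycles

open Finset Matrix

variable {n h : ℕ}

open Classical in
-- The parity condition is symmetric in the vertices, so one ordering suffices.
theorem evenOn_triple {G : SimpleGraph (Fin n)} {a b c : Fin n}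
    (habc : (if G.Adj a b then 1 else 0) + (if G.Adj a c then 1 else 0) +
      (if G.Adj b c then 1 else 0) = (0 : ZMod 2)) : EvenOn G {a, b, c} := by
  intro u x y hux huy hxy he
  obtain ⟨g, hg⟩ : ∃ g : Fin n → Fin n → ZMod 2, ∀ x y, g x y = if G.Adj x y then 1 else 0 :=
    ⟨_, fun _ _ => rfl⟩
  have hs : ∀ x y, g x y = g y x := fun x y => by rw [hg, hg, G.adj_comm]
  simp only [← hg] at habc ⊢
  have h1 : u ∈ ({a, b, c} : Finset (Fin n)) := by rw [he]; simp
  have h2 : x ∈ ({a, b, c} : Finset (Fin n)) := by rw [he]; simp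
  have h3 : y ∈ ({a, b, c} : Finset (Fin n)) := by rw [he]; simp
  simp only [Finset.mem_insert, Finset.mem_singleton] at h1 h2 h3
  clear he hg
  rcases h1 with rfl | rfl | rfl <;> rcases h2 with rfl | rfl | rfl <;>
    rcases h3 with rfl | rfl | rfl <;> grind

/-- The cyclic successor in a disjoint union of 5-cycles. -/
def next (p : Fin h × Fin 5) : Fin h × Fin 5 := (p.1, p.2 + 1)

theorem next_ne (p : Fin h × Fin 5) : next p ≠ p := by
  obtain ⟨i, j⟩ := p
  intro hp
  have : j + 1 = j := congrArg Prod.snd hp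
  clear hp
  revert this; revert j; decide

theorem next_next_ne (p : Fin h × Fin 5) : next (next p) ≠ p := by
  obtain ⟨i, j⟩ := p
  intro hp
  have : j + 1 + 1 = j := congrArg Prod.snd hp
  clear hp
  revert this; revert j; decide

theorem next_next_next_ne (p : Fin h × Fin 5) : next (next (next p)) ≠ p := by
  obtain ⟨i, j⟩ := p
  intro hp
  have : j + 1 + 1 + 1 = j := congrArg Prod.snd hp
  clear hp
  revert this; revert j; decide

theorem next_injective : Function.Injective (next : Fin h × Fin 5 → Fin h × Fin 5) := by
  rintro ⟨i, j⟩ ⟨i', j'⟩ hp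
  simp only [next, Prod.mk.injEq, add_left_inj] at hp
  rw [hp.1, hp.2]

theorem next_five (p : Fin h × Fin 5) : next (next (next (next (next p)))) = p := by
  obtain ⟨i, j⟩ := p
  refine Prod.ext rfl ?_
  change j + 1 + 1 + 1 + 1 + 1 = j
  revert j; decide

/-- `G` is the disjoint union of the 5-cycles parametrized by `v`. -/
structure IsFiveCycles (G : SimpleGraph (Fin n)) (v : Fin h × Fin 5 → Fin n) : Prop where
  inj : Function.Injective v
  edgeSet_eq : G.edgeSet = Set.range fun p => s(v p, v (next p))

variable {G : SimpleGraph (Fin n)} {v : Fin h × Fin 5 → Fin n}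

theorem IsFiveCycles.adj_iff (hG : IsFiveCycles G v) {x y : Fin n} :
    G.Adj x y ↔ ∃ p, (x = v p ∧ y = v (next p)) ∨ (x = v (next p) ∧ y = v p) := by
  rw [← SimpleGraph.mem_edgeSet, hG.edgeSet_eq]
  simp only [Set.mem_range, Sym2.eq_iff]
  refine exists_congr fun p => ?_
  constructor <;> rintro (⟨h1, h2⟩ | ⟨h1, h2⟩) <;> simp [h1, h2]

theorem IsFiveCycles.adj_next (hG : IsFiveCycles G v) (p : Fin h × Fin 5) :
    G.Adj (v p) (v (next p)) := hG.adj_iff.2 ⟨p, Or.inl ⟨rfl, rfl⟩⟩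

theorem IsFiveCycles.adj_apply_iff (hG : IsFiveCycles G v) {p q : Fin h × Fin 5} :
    G.Adj (v p) (v q) ↔ q = next p ∨ p = next q := by
  rw [hG.adj_iff]
  constructor
  · rintro ⟨r, ⟨h1, h2⟩ | ⟨h1, h2⟩⟩
    · rw [hG.inj h1, hG.inj h2]; exact Or.inl rfl
    · rw [hG.inj h1, hG.inj h2]; exact Or.inr rfl
  · rintro (rfl | rfl)
    · exact ⟨p, Or.inl ⟨rfl, rfl⟩⟩
    · exact ⟨q, Or.inr ⟨rfl, rfl⟩⟩

theorem IsFiveCycles.isEdge_iff (hG : IsFiveCycles G v) {e : Finset (Fin n)} :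
    IsEdge G e ↔ ∃ p, e = {v p, v (next p)} := by
  constructor
  · rintro ⟨x, y, hxy, rfl⟩
    obtain ⟨p, ⟨rfl, rfl⟩ | ⟨rfl, rfl⟩⟩ := hG.adj_iff.1 hxy
    · exact ⟨p, rfl⟩
    · exact ⟨p, Finset.pair_comm _ _⟩
  · rintro ⟨p, rfl⟩
    exact isEdge_pair.2 (hG.adj_next p)

theorem IsFiveCycles.card_edges_le (hG : IsFiveCycles G v) : (edges G).card ≤ 5 * h := by
  have : edges G ⊆ univ.image fun p => ({v p, v (next p)} : Finset (Fin n)) := by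
    intro e he
    obtain ⟨p, rfl⟩ := hG.isEdge_iff.1 (mem_edges.1 he)
    exact mem_image_of_mem _ (mem_univ p)
  refine (Finset.card_le_card this).trans (Finset.card_image_le.trans ?_)
  simp [mul_comm]

theorem pair_next_injective (hv : Function.Injective v) :
    Function.Injective fun p => ({v p, v (next p)} : Finset (Fin n)) := by
  intro p q hpq
  change ({v p, v (next p)} : Finset (Fin n)) = {v q, v (next q)} at hpq
  have h1 : v p ∈ ({v q, v (next q)} : Finset (Fin n)) := by
    rw [← hpq]; simp
  have h2 : v (next p) ∈ ({v q, v (next q)} : Finset (Fin n)) := by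
    rw [← hpq]; simp
  simp only [Finset.mem_insert, Finset.mem_singleton, hv.eq_iff] at h1 h2
  rcases h1 with rfl | rfl
  · rfl
  · rcases h2 with h2 | h2
    · exact absurd h2 (next_next_ne q)
    · exact (next_injective h2)

theorem triple_next_distinct (hv : Function.Injective v) (p : Fin h × Fin 5) :
    v p ≠ v (next p) ∧ v p ≠ v (next (next p)) ∧ v (next p) ≠ v (next (next p)) :=
  ⟨fun h => next_ne p (hv h).symm, fun h => next_next_ne p (hv h).symm,
    fun h => next_ne (next p) (hv h).symm⟩

/-- The triangles of the Möbius strips spanned by the 5-cycles. -/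
def mobiusTri (hv : Function.Injective v) (p : Fin h × Fin 5) : Tri n :=
  ⟨{v p, v (next p), v (next (next p))}, Finset.card_eq_three.2 ⟨_, _, _,
    (triple_next_distinct hv p).1, (triple_next_distinct hv p).2.1,
    (triple_next_distinct hv p).2.2, rfl⟩⟩

theorem pair_next_subset_mobiusTri (hv : Function.Injective v) {p q : Fin h × Fin 5} :
    ({v q, v (next q)} : Finset (Fin n)) ⊆ (mobiusTri hv p).1 ↔ q = p ∨ q = next p := by
  simp only [mobiusTri, Finset.insert_subset_iff, Finset.singleton_subset_iff, Finset.mem_insert,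
    Finset.mem_singleton, hv.eq_iff]
  constructor
  · rintro ⟨rfl | rfl | rfl, h2⟩
    · exact Or.inl rfl
    · exact Or.inr rfl
    · rcases h2 with h2 | h2 | h2
      · exact absurd h2 (next_next_next_ne p)
      · exact absurd h2 (next_next_ne (next p))
      · exact absurd h2 (next_ne _)
  · rintro (rfl | rfl) <;> simp

theorem mobiusTri_injective (hv : Function.Injective v) : Function.Injective (mobiusTri hv) := by
  intro p q hpq
  have h1 := (pair_next_subset_mobiusTri hv (p := p) (q := p)).2 (Or.inl rfl)
  have h2 := (pair_next_subset_mobiusTri hv (p := p) (q := next p)).2 (Or.inr rfl)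
  rw [hpq, pair_next_subset_mobiusTri] at h1 h2
  rcases h1 with h1 | rfl
  · exact h1
  · rcases h2 with h2 | h2
    · exact absurd h2 (next_next_ne q)
    · exact absurd h2 (next_ne _)

theorem mobiusTri_notMem_flagTri (hG : IsFiveCycles G v) (p : Fin h × Fin 5) :
    mobiusTri hG.inj p ∉ flagTri G := fun hp =>
  mem_flagTri.1 hp _ ((pair_next_subset_mobiusTri hG.inj).2 (Or.inl rfl))
    (isEdge_pair.2 (hG.adj_next p))

theorem evenOn_of_mem_flagTri {t : Tri n} (ht : t ∈ flagTri G) : EvenOn G t.1 := by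
  obtain ⟨a, b, c, -, -, -, habc⟩ := Finset.card_eq_three.1 t.2
  have h1 : ∀ x ∈ t.1, ∀ y ∈ t.1, ¬ G.Adj x y := by
    intro x hx y hy hxy
    refine mem_flagTri.1 ht {x, y} ?_ (isEdge_pair.2 hxy)
    simp [Finset.insert_subset_iff, hx, hy]
  have ha : a ∈ t.1 := by simp [habc]
  have hb : b ∈ t.1 := by simp [habc]
  have hc : c ∈ t.1 := by simp [habc]
  rw [habc]
  exact evenOn_triple (by simp [h1 a ha b hb, h1 a ha c hc, h1 b hb c hc])

theorem evenOn_mobiusTri (hG : IsFiveCycles G v) (p : Fin h × Fin 5) :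
    EvenOn G (mobiusTri hG.inj p).1 := by
  refine evenOn_triple ?_
  have h3 : ¬ G.Adj (v p) (v (next (next p))) := by
    rw [hG.adj_apply_iff]
    rintro (h1 | h1)
    · exact next_ne _ h1
    · exact next_next_next_ne p h1.symm
  rw [if_pos (hG.adj_next p), if_neg h3, if_pos (hG.adj_next _)]
  decide

/-- The incidence matrix between the edges of the 5-cycles and the triangles of the Möbius
strips. -/
def mobiusMatrix (hv : Function.Injective v) : Matrix (Fin h × Fin 5) (Fin h × Fin 5) ℤ :=
  fun p q => incidence {v p, v (next p)} (mobiusTri hv q).1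

/-- Each strip triangle meets exactly two cycle edges, so a left kernel vector, after normalising by
`sg`, changes sign from each edge to the next. Going round an odd cycle makes every entry its own
negative. -/
theorem det_mobiusMatrix_ne_zero (hv : Function.Injective v) : (mobiusMatrix hv).det ≠ 0 := by
  intro h0
  obtain ⟨x, hx0, hx⟩ := Matrix.exists_vecMul_eq_zero_iff.2 h0
  refine hx0 (funext fun p => ?_)
  have key : ∀ q, sg (v q) (v (next q)) * x q =
      -(sg (v (next q)) (v (next (next q))) * x (next q)) := by
    intro q
    have h1 : ∑ p, x p * mobiusMatrix hv p q = 0 := congrFun hx q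
    obtain ⟨hab, hac, hbc⟩ := triple_next_distinct hv q
    rw [Fintype.sum_eq_add q (next q) (next_ne q).symm] at h1
    · simp only [mobiusMatrix, mobiusTri] at h1
      have h3 : ({v q, v (next q), v (next (next q))} : Finset (Fin n)) =
          {v (next q), v (next (next q)), v q} := by ext; simp; tauto
      rw [incidence_triple hab hac hbc, h3, incidence_triple hbc hab.symm hac.symm, sg_swap hab,
        sg_swap hac] at h1
      have e1 := sg_mul_self (v q) (v (next q))
      have e2 := sg_mul_self (v q) (v (next (next q)))
      have e3 := sg_mul_self (v (next q)) (v (next (next q)))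
      set A := sg (v q) (v (next q))
      set C := sg (v q) (v (next (next q)))
      set B := sg (v (next q)) (v (next (next q)))
      have h4 : x q * B + x (next q) * A = 0 := by
        linear_combination C * h1 - (x q * B + x (next q) * A) * e2
      linear_combination A * B * h4 - (A * x q) * e3 - (B * x (next q)) * e1
    · rintro p ⟨h1, h2⟩
      refine mul_eq_zero_of_right _ ?_
      by_contra hne
      rcases (pair_next_subset_mobiusTri hv).1 (subset_of_incidence_ne_zero hne) with h | h
      · exact h1 h
      · exact h2 h
  have h5 : sg (v p) (v (next p)) * x p = -(sg (v p) (v (next p)) * x p) := by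
    have k1 := key p
    have k2 := key (next p)
    have k3 := key (next (next p))
    have k4 := key (next (next (next p)))
    have k5 := key (next (next (next (next p))))
    rw [next_five p] at k4 k5
    linarith
  have h6 : sg (v p) (v (next p)) * x p = 0 := by linarith
  have h7 := sg_mul_self (v p) (v (next p))
  rw [Pi.zero_apply]
  linear_combination sg (v p) (v (next p)) * h6 - x p * h7

/-- The non-base pairs are the non-edges of `G` and the edges of the 5-cycles. -/
def rowEquiv (hG : IsFiveCycles G v) {b : Fin n} (hb : ∀ p, v p ≠ b) :
    Row G b ⊕ (Fin h × Fin 5) ≃ Row ⊥ b :=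
  Equiv.ofBijective
    (Sum.elim (fun e => ⟨e.1, e.2.1, e.2.2.1, not_isEdge_bot _⟩)
      fun p => ⟨{v p, v (next p)}, card_pair (triple_next_distinct hG.inj p).1,
        by simp [(hb p).symm, (hb (next p)).symm], not_isEdge_bot _⟩) (by
    constructor
    · rintro (e | p) (e' | q) heq
      · exact congrArg Sum.inl (Subtype.ext (congrArg (fun s : Row ⊥ b => s.1) heq))
      · have h1 : e.1 = {v q, v (next q)} := congrArg (fun s : Row ⊥ b => s.1) heq
        exact absurd (hG.isEdge_iff.2 ⟨q, h1⟩) e.2.2.2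
      · have h1 : {v p, v (next p)} = e'.1 := congrArg (fun s : Row ⊥ b => s.1) heq
        exact absurd (hG.isEdge_iff.2 ⟨p, h1.symm⟩) e'.2.2.2
      · exact congrArg Sum.inr (pair_next_injective hG.inj
          (congrArg (fun s : Row ⊥ b => s.1) heq))
    · intro e
      by_cases he : IsEdge G e.1
      · obtain ⟨p, hp⟩ := hG.isEdge_iff.1 he
        exact ⟨Sum.inr p, Subtype.ext hp.symm⟩
      · exact ⟨Sum.inl ⟨e.1, e.2.1, e.2.2.1, he⟩, rfl⟩)

theorem card_row_add (hG : IsFiveCycles G v) {b : Fin n} (hb : ∀ p, v p ≠ b) :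
    Fintype.card (Row G b) + 5 * h = (n - 1).choose 2 := by
  rw [← card_row_bot b, ← Fintype.card_congr (rowEquiv hG hb), Fintype.card_sum]
  simp [mul_comm]

/-- Flag triangles vanish on the rows of cycle edges. Splitting rows into non-edges and cycle edges,
the matrix is P · diag(`flagLap`, 1) · Pᵀ with P block triangular with diagonal blocks 1 and the
Möbius matrix. -/
theorem det_gram_flagTri_mobiusTri (hG : IsFiveCycles G v) {b : Fin n} (hb : ∀ p, v p ≠ b) :
    (gram (rowBoundary ⊥ b ℝ) fun t =>
      if t ∈ flagTri G ∨ t ∈ univ.image (mobiusTri hG.inj) then 1 else 0).det =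
      ((mobiusMatrix hG.inj).det : ℝ) ^ 2 * (flagLap G b).det := by
  set W := gram (rowBoundary ⊥ b ℝ) fun t =>
      if t ∈ flagTri G ∨ t ∈ univ.image (mobiusTri hG.inj) then 1 else 0 with hW
  set M : Matrix (Fin h × Fin 5) (Fin h × Fin 5) ℝ :=
    (mobiusMatrix hG.inj).map (Int.castRingHom ℝ) with hM
  have hMdet : M.det = ((mobiusMatrix hG.inj).det : ℝ) := by
    change ((Int.castRingHom ℝ).mapMatrix (mobiusMatrix hG.inj)).det = _
    rw [← RingHom.map_det]; rfl
  set Q : Matrix (Row G b) (Fin h × Fin 5) ℝ :=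
    fun e p => (incidence e.1 (mobiusTri hG.inj p).1 : ℝ) with hQ
  have hsplit : ∀ e e' : Row ⊥ b, W e e' =
      (∑ t, (incidence e.1 t.1 : ℝ) * (if t ∈ flagTri G then 1 else 0) * incidence e'.1 t.1) +
      ∑ p, (incidence e.1 (mobiusTri hG.inj p).1 : ℝ) *
        incidence e'.1 (mobiusTri hG.inj p).1 := by
    intro e e'
    have h1 : ∑ p, (incidence e.1 (mobiusTri hG.inj p).1 : ℝ) *
        incidence e'.1 (mobiusTri hG.inj p).1 =
        ∑ t : Tri n, (incidence e.1 t.1 : ℝ) *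
          (if t ∈ univ.image (mobiusTri hG.inj) then 1 else 0) * incidence e'.1 t.1 := by
      refine Fintype.sum_of_injective (mobiusTri hG.inj) (mobiusTri_injective hG.inj) _ _ ?_ ?_
      · intro t ht
        rw [if_neg]
        · ring
        · rw [mem_image]
          rintro ⟨p, -, hp⟩
          exact ht ⟨p, hp⟩
      · intro p
        rw [if_pos (mem_image_of_mem _ (mem_univ p)), mul_one]
    rw [h1, hW, gram_apply, ← Finset.sum_add_distrib]
    refine Finset.sum_congr rfl fun t _ => ?_
    simp only [rowBoundary]
    by_cases hf : t ∈ flagTri G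
    · have : t ∉ univ.image (mobiusTri hG.inj) := by
        rw [mem_image]
        rintro ⟨p, -, rfl⟩
        exact mobiusTri_notMem_flagTri hG p hf
      simp [hf, this]
    · simp only [hf, false_or, if_false]
      ring
  have hflag0 : ∀ (p : Fin h × Fin 5) (t : Tri n), t ∈ flagTri G →
      incidence {v p, v (next p)} t.1 = 0 := by
    intro p t ht
    by_contra h0
    exact mem_flagTri.1 ht _ (subset_of_incidence_ne_zero h0) (isEdge_pair.2 (hG.adj_next p))
  have hblock : W.submatrix (rowEquiv hG hb) (rowEquiv hG hb) =
      Matrix.fromBlocks 1 Q 0 M * Matrix.fromBlocks (flagLap G b) 0 0 1 *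
        (Matrix.fromBlocks 1 Q 0 M)ᵀ := by
    rw [Matrix.fromBlocks_transpose, Matrix.fromBlocks_multiply, Matrix.fromBlocks_multiply]
    simp only [Matrix.one_mul, Matrix.mul_zero, add_zero, zero_add, Matrix.zero_mul, Matrix.mul_one,
      Matrix.transpose_one, Matrix.transpose_zero]
    ext (e | p) (e' | q)
    · simp only [Matrix.submatrix_apply, Matrix.fromBlocks_apply₁₁, hsplit, Matrix.add_apply]
      congr 1
      simp only [flagLap, gram_apply]
      rfl
    · simp only [Matrix.submatrix_apply, Matrix.fromBlocks_apply₁₂, hsplit]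
      rw [Finset.sum_eq_zero, zero_add]
      · rfl
      · intro t _
        by_cases ht : t ∈ flagTri G
        · have : incidence (rowEquiv hG hb (Sum.inr q)).1 t.1 = 0 := hflag0 q t ht
          simp [this]
        · simp [ht]
    · simp only [Matrix.submatrix_apply, Matrix.fromBlocks_apply₂₁, hsplit]
      rw [Finset.sum_eq_zero, zero_add]
      · rfl
      · intro t _
        by_cases ht : t ∈ flagTri G
        · have : incidence (rowEquiv hG hb (Sum.inr p)).1 t.1 = 0 := hflag0 p t ht
          simp [this]
        · simp [ht]
    · simp only [Matrix.submatrix_apply, Matrix.fromBlocks_apply₂₂, hsplit]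
      rw [Finset.sum_eq_zero, zero_add]
      · rfl
      · intro t _
        by_cases ht : t ∈ flagTri G
        · have : incidence (rowEquiv hG hb (Sum.inr p)).1 t.1 = 0 := hflag0 p t ht
          simp [this]
        · simp [ht]
  rw [← Matrix.det_submatrix_equiv_self (rowEquiv hG hb) W, hblock, Matrix.det_mul, Matrix.det_mul,
    Matrix.det_transpose, Matrix.det_fromBlocks_zero₂₁, Matrix.det_fromBlocks_zero₂₁, Matrix.det_one,
    Matrix.det_one, ← hMdet]
  ring

open Classical in
-- The Möbius determinant is a nonzero integer, so its square is at least 1. Flag and Möbius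
-- triangles are all even, and enlarging the set of allowed triangles increases the determinant.
theorem det_flagLap_le_weight (hG : IsFiveCycles G v) {b : Fin n} (hb : ∀ p, v p ≠ b) :
    (flagLap G b).det ≤ weight b (univ.filter fun t => EvenOn G t.1) := by
  have h1 : (1 : ℝ) ≤ ((mobiusMatrix hG.inj).det : ℝ) ^ 2 := by
    have h2 : (1 : ℤ) ≤ (mobiusMatrix hG.inj).det ^ 2 :=
      (sq_pos_of_ne_zero (det_mobiusMatrix_ne_zero hG.inj) : (0 : ℤ) < _)
    exact_mod_cast h2
  calc (flagLap G b).det ≤ ((mobiusMatrix hG.inj).det : ℝ) ^ 2 * (flagLap G b).det :=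
        le_mul_of_one_le_left (det_gram_indicator_nonneg _ _) h1
    _ = _ := (det_gram_flagTri_mobiusTri hG hb).symm
    _ ≤ _ := by
        refine det_gram_mono _ (fun t => by split_ifs <;> norm_num) fun t => ?_
        by_cases ht : t ∈ flagTri G ∨ t ∈ univ.image (mobiusTri hG.inj)
        · have he : EvenOn G t.1 := by
            rcases ht with ht | ht
            · exact evenOn_of_mem_flagTri ht
            · obtain ⟨p, -, rfl⟩ := mem_image.1 ht
              exact evenOn_mobiusTri hG p
          rw [if_pos ht]
          simp [he]
        · rw [if_neg ht]
          split_ifs <;> norm_num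

open Classical in
/-- Lower bound for the probability that a union of 5-cycles is a cocycle. -/
theorem le_weight_evenOn_div (hG : IsFiveCycles G v) {b : Fin n} (hb : ∀ p, v p ≠ b)
    (hh : 0 < h) (hn : 30 * h ≤ n) :
    Real.exp (-(30 * h)) / (n : ℝ) ^ (5 * h) ≤
      weight b (univ.filter fun t => EvenOn G t.1) / (n : ℝ) ^ ((n - 2).choose 2) := by
  have hn0 : (0 : ℝ) < n := by exact_mod_cast (by omega : 0 < n)
  have hbG : ∀ x, ¬ G.Adj b x := by
    intro x hx
    obtain ⟨p, ⟨h1, -⟩ | ⟨h1, -⟩⟩ := hG.adj_iff.1 hx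
    · exact hb _ h1.symm
    · exact hb _ h1.symm
  have hV : ∀ x y, G.Adj x y → x ∈ univ.image v := by
    intro x y hxy
    obtain ⟨p, ⟨rfl, -⟩ | ⟨rfl, -⟩⟩ := hG.adj_iff.1 hxy
    · exact mem_image_of_mem _ (mem_univ _)
    · exact mem_image_of_mem _ (mem_univ _)
  have hVc : (univ.image v).card = 5 * h := by
    rw [Finset.card_image_of_injective _ hG.inj]; simp [mul_comm]
  have h1 := le_det_flagLap hbG hV (by omega) (by rw [hVc]; omega)
  have h2 : Real.exp (-(30 * h)) ≤ Real.exp (-(6 * (edges G).card)) := by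
    rw [Real.exp_le_exp, neg_le_neg_iff]
    have : ((edges G).card : ℝ) ≤ 5 * h := by exact_mod_cast hG.card_edges_le
    linarith
  have h3 := (mul_le_mul_of_nonneg_left h2 (by positivity :
    0 ≤ (n : ℝ) ^ Fintype.card (Row G b))).trans (h1.trans
      (mul_le_mul_of_nonneg_right (det_flagLap_le_weight hG hb) (by positivity)))
  rw [div_le_div_iff₀ (by positivity) (by positivity)]
  -- The 5h missing rows produce the factor n^(-5h), and C(n-1,2) = C(n-2,2) + (n-2) lets Cayley's
  -- factor cancel.
  have h4 : (n : ℝ) ^ Fintype.card (Row G b) * (n : ℝ) ^ (5 * h) =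
      (n : ℝ) ^ ((n - 2).choose 2) * (n : ℝ) ^ (n - 2) := by
    rw [← pow_add, ← pow_add, card_row_add hG hb, choose_two_eq (by omega)]
  refine le_of_mul_le_mul_right ?_ (by positivity : (0 : ℝ) < (n : ℝ) ^ (n - 2))
  calc Real.exp (-(30 * h)) * (n : ℝ) ^ ((n - 2).choose 2) * (n : ℝ) ^ (n - 2)
      = (n : ℝ) ^ Fintype.card (Row G b) * Real.exp (-(30 * h)) * (n : ℝ) ^ (5 * h) := by
        rw [mul_assoc, ← h4]; ring
    _ ≤ _ := mul_le_mul_of_nonneg_right h3 (by positivity)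
    _ = _ := by ring

end FiveCycles

/-! ### Upper bound for the probability that two graphs are both cocycles -/

section Pairs

open Finset Matrix

variable {n : ℕ}

open Classical in
/-- The triangles that contain two edges of `H`. -/
def cherryTri (H : SimpleGraph (Fin n)) : Finset (Tri n) :=
  univ.filter fun t => ∃ u x y, x ≠ y ∧ t.1 = {u, x, y} ∧ H.Adj u x ∧ H.Adj u y

theorem mem_cherryTri {H : SimpleGraph (Fin n)} {t : Tri n} :
    t ∈ cherryTri H ↔ ∃ u x y, x ≠ y ∧ t.1 = {u, x, y} ∧ H.Adj u x ∧ H.Adj u y := by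
  simp [cherryTri]

theorem exists_adj_of_evenOn {G : SimpleGraph (Fin n)} {x y z : Fin n} (hxy : x ≠ y)
    (hxz : x ≠ z) (hyz : y ≠ z) (h : EvenOn G {x, y, z}) (hG : G.Adj x y) :
    G.Adj x z ∨ G.Adj y z := by
  by_contra! hcon
  have h1 := h x y z hxy hxz hyz rfl
  rw [if_pos hG, if_neg hcon.1, if_neg hcon.2] at h1
  exact absurd h1 (by decide)

/-- An edge of one `Gᵢ` in the triangle forces, by parity for the same `Gᵢ`, a second one. -/
theorem mem_flagTri_or_mem_cherryTri {G₁ G₂ : SimpleGraph (Fin n)} {t : Tri n}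
    (h₁ : EvenOn G₁ t.1) (h₂ : EvenOn G₂ t.1) :
    t ∈ flagTri (G₁ ⊔ G₂) ∨ t ∈ cherryTri (G₁ ⊔ G₂) := by
  refine or_iff_not_imp_left.2 fun hf => ?_
  simp only [mem_flagTri, not_forall, not_not] at hf
  obtain ⟨e, het, x, y, hxy, rfl⟩ := hf
  have hc : (t.1 \ {x, y}).card = 1 := by
    rw [Finset.card_sdiff_of_subset het, t.2, card_pair hxy.ne]
  obtain ⟨z, hz⟩ := Finset.card_eq_one.1 hc
  have hzm : z ∈ t.1 \ {x, y} := by rw [hz]; simp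
  have ht : t.1 = {x, y, z} := by
    rw [← Finset.sdiff_union_of_subset het, hz]; ext w; simp; tauto
  have ht' : t.1 = {y, x, z} := by rw [ht]; ext w; simp; tauto
  simp only [Finset.mem_sdiff, Finset.mem_insert, Finset.mem_singleton, not_or] at hzm
  have hxz : x ≠ z := Ne.symm hzm.2.1
  have hyz : y ≠ z := Ne.symm hzm.2.2
  have key : (G₁ ⊔ G₂).Adj x z ∨ (G₁ ⊔ G₂).Adj y z := by
    rcases hxy with hG | hG
    · exact (exists_adj_of_evenOn hG.ne hxz hyz (ht ▸ h₁) hG).imp Or.inl Or.inl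
    · exact (exists_adj_of_evenOn hG.ne hxz hyz (ht ▸ h₂) hG).imp Or.inr Or.inr
  rcases key with hk | hk
  · exact mem_cherryTri.2 ⟨x, y, z, hyz, ht, hxy, hk⟩
  · exact mem_cherryTri.2 ⟨y, x, z, hxz, ht', hxy.symm, hk⟩

/-- In a hypertree without triangles that contain exactly one edge of `H`, at least as many
triangles as `H` has edges contain two edges of `H`. -/
theorem card_edges_le_card_inter_cherryTri {H : SimpleGraph (Fin n)} {b : Fin n}
    (hb : ∀ x, ¬ H.Adj b x) {A : Finset (Tri n)} (hA : ∀ t ∈ A, t ∈ flagTri H ∨ t ∈ cherryTri H)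
    (hw : weight b A ≠ 0) : (edges H).card ≤ (A ∩ cherryTri H).card := by
  -- With fewer cherry triangles than edges, some nonzero vector on the edges of `H` is orthogonal
  -- to all those triangles. Extended by zero it is also orthogonal to the flag triangles, which
  -- contain no edge of `H`, and so makes the Gram matrix singular.
  by_contra! hlt
  let M : Matrix {t // t ∈ A ∩ cherryTri H} {e // e ∈ edges H} ℝ :=
    fun t e => (incidence e.1 t.1.1 : ℝ)
  have hker : LinearMap.ker M.mulVecLin ≠ ⊥ := by
    refine LinearMap.ker_ne_bot_of_finrank_lt ?_
    rwa [Module.finrank_fintype_fun_eq_card, Module.finrank_fintype_fun_eq_card,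
      Fintype.card_coe, Fintype.card_coe]
  obtain ⟨y, hy, hy0⟩ := Submodule.exists_mem_ne_zero_of_ne_bot hker
  refine hw ?_
  refine Matrix.exists_vecMul_eq_zero_iff.1
    ⟨fun e => if he : e.1 ∈ edges H then y ⟨e.1, he⟩ else 0, ?_, ?_⟩
  · intro h0
    refine hy0 (funext fun e => ?_)
    have hbe : b ∉ e.1 := by
      intro hbe
      have he := mem_edges.1 e.2
      obtain ⟨x, -, hx⟩ := exists_eq_pair he.card_eq_two hbe
      rw [hx] at he
      exact hb x (isEdge_pair.1 he)
    have h1 := congrFun h0 ⟨e.1, (mem_edges.1 e.2).card_eq_two, hbe, not_isEdge_bot _⟩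
    simpa using h1
  · have hsum : ∀ t ∈ A, ∑ e : Row ⊥ b, (if he : e.1 ∈ edges H then y ⟨e.1, he⟩ else 0) *
        (incidence e.1 t.1 : ℝ) = 0 := by
      intro t ht
      rcases hA t ht with hf | hc
      · refine Finset.sum_eq_zero fun e _ => ?_
        split_ifs with he
        · have : incidence e.1 t.1 = 0 := by
            by_contra h0
            exact mem_flagTri.1 hf _ (subset_of_incidence_ne_zero h0) (mem_edges.1 he)
          simp [this]
        · simp
      · have h1 : ∑ e : {e // e ∈ edges H}, (incidence e.1 t.1 : ℝ) * y e = 0 :=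
          congrFun (LinearMap.mem_ker.1 hy) ⟨t, mem_inter.2 ⟨ht, hc⟩⟩
        refine Eq.trans (Eq.symm ?_) h1
        refine Fintype.sum_of_injective (fun e : {e // e ∈ edges H} => (⟨e.1,
          (mem_edges.1 e.2).card_eq_two, ?_, not_isEdge_bot _⟩ : Row ⊥ b)) ?_ _ _ ?_ ?_
        · intro hbe
          have he := mem_edges.1 e.2
          obtain ⟨x, -, hx⟩ := exists_eq_pair he.card_eq_two hbe
          rw [hx] at he
          exact hb x (isEdge_pair.1 he)
        · exact fun e e' h => Subtype.ext (congrArg (fun s : Row ⊥ b => s.1) h)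
        · intro e he
          rw [dif_neg, zero_mul]
          exact fun hm => he ⟨⟨e.1, hm⟩, rfl⟩
        · intro e
          rw [dif_pos e.2, mul_comm]
    ext e'
    simp only [Matrix.vecMul, dotProduct, gram_apply, Finset.mul_sum, Pi.zero_apply]
    rw [Finset.sum_comm]
    refine Finset.sum_eq_zero fun t _ => ?_
    by_cases ht : t ∈ A
    · have h2 := hsum t ht
      calc _ = (∑ e : Row ⊥ b, (if he : e.1 ∈ edges H then y ⟨e.1, he⟩ else 0) *
            (incidence e.1 t.1 : ℝ)) * incidence e'.1 t.1 := by
            rw [Finset.sum_mul]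
            refine Finset.sum_congr rfl fun e _ => ?_
            simp only [rowBoundary, ht, if_true]
            ring
        _ = 0 := by rw [h2, zero_mul]
    · simp [ht]

/-- Sylvester's identity passes to a |K| × |K| positive semidefinite matrix. Its diagonal is at most
1 + 3, a triangle having three edges. -/
theorem det_one_add_gram_indicator_le (b : Fin n) (K : Finset (Tri n)) :
    (1 + gram (rowBoundary ⊥ b ℝ) fun t => if t ∈ K then 1 else 0).det ≤ 4 ^ K.card := by
  let N : Matrix (Row ⊥ b) {t // t ∈ K} ℝ := fun e t => (incidence e.1 t.1.1 : ℝ)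
  have hN : gram (rowBoundary ⊥ b ℝ) (fun t => if t ∈ K then 1 else 0) = N * Nᵀ := by
    ext e e'
    rw [gram_apply, Matrix.mul_apply]
    symm
    refine Fintype.sum_of_injective Subtype.val Subtype.val_injective _ _ ?_ ?_
    · intro t ht
      have : t ∉ K := fun h => ht ⟨⟨t, h⟩, rfl⟩
      simp [this]
    · intro t
      rw [if_pos t.2, mul_one]
      rfl
  rw [hN, Matrix.det_one_add_mul_comm]
  have hpos : (1 + Nᵀ * N).PosSemidef := by
    refine Matrix.PosSemidef.one.add ?_
    have := Matrix.posSemidef_conjTranspose_mul_self N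
    rwa [conjTranspose_eq_transpose_of_trivial] at this
  have h := det_le_pow_of_diag_le hpos (c := 4) fun t => by
    simp only [Matrix.add_apply, Matrix.one_apply_eq, Matrix.mul_apply, Matrix.transpose_apply]
    have h1 : ∑ e, N e t * N e t ≤ 3 := by
      refine le_trans (Finset.sum_le_sum fun e _ => ?_) (sum_abs_rowBoundary_le ⊥ b t.1)
      rw [← abs_mul_abs_self]
      exact mul_le_of_le_one_left (abs_nonneg _) (abs_incidence_le_one _ _)
    linarith
  rwa [Fintype.card_coe] at h

/-- With L the full reduced up-Laplacian and W the part from `K`, triangles avoiding `b` have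
boundaries killed by `rowDown`; hence LW = nW. The weighted matrix L + nW is therefore L(1 + W),
which avoids any loss in powers of n. -/
theorem det_gram_one_add_le {b : Fin n} (hn : 2 ≤ n) {K : Finset (Tri n)}
    (hK : ∀ t ∈ K, b ∉ t.1) :
    (gram (rowBoundary ⊥ b ℝ) fun t => if t ∈ K then 1 + (n : ℝ) else 1).det ≤
      (n : ℝ) ^ ((n - 2).choose 2) * 4 ^ K.card := by
  set W := gram (rowBoundary ⊥ b ℝ) fun t => if t ∈ K then 1 else 0 with hW
  have hall : ∀ t : Tri n, t ∈ flagTri (⊥ : SimpleGraph (Fin n)) := fun t =>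
    mem_flagTri.2 fun e _ => not_isEdge_bot e
  have hDW : rowDown ⊥ b * W = 0 := by
    have h1 : rowDown ⊥ b * rowBoundary ⊥ b ℝ * (diagonal fun t => if t ∈ K then (1 : ℝ) else 0) =
        0 := by
      ext v t
      rw [Matrix.mul_diagonal]
      by_cases ht : t ∈ K
      · have h2 := sum_row_incidence_of_notMem v (hall t) (hK t ht)
        have h3 : (rowDown ⊥ b * rowBoundary ⊥ b ℝ) v t =
            ((∑ e : Row ⊥ b, incidence {v} e.1 * incidence e.1 t.1 : ℤ) : ℝ) := by
          simp [Matrix.mul_apply, rowDown, rowBoundary]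
        rw [h3, h2]; simp
      · simp [ht]
    rw [hW, gram, ← Matrix.mul_assoc, ← Matrix.mul_assoc, h1, Matrix.zero_mul]
  have hL : flagLap ⊥ b * W = (n : ℝ) • W := by
    have h1 := flagLap_add_badLap (⊥ : SimpleGraph (Fin n)) b
    rw [badLap_bot, add_zero] at h1
    have h2 := congrArg (· * W) h1
    simp only [Matrix.add_mul, Matrix.mul_assoc, hDW, Matrix.mul_zero, add_zero, Matrix.smul_mul,
      Matrix.one_mul] at h2
    exact h2
  have hsum : gram (rowBoundary ⊥ b ℝ) (fun t => if t ∈ K then 1 + (n : ℝ) else 1) =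
      flagLap ⊥ b * (1 + W) := by
    rw [Matrix.mul_add, Matrix.mul_one, hL]
    ext e e'
    simp only [Matrix.add_apply, Matrix.smul_apply, hW, flagLap, gram_apply, smul_eq_mul,
      Finset.mul_sum, ← Finset.sum_add_distrib, hall, if_true]
    refine Finset.sum_congr rfl fun t _ => ?_
    split_ifs <;> ring
  rw [hsum, Matrix.det_mul, det_flagLap_bot b hn]
  exact mul_le_mul_of_nonneg_left (det_one_add_gram_indicator_le b K) (by positivity)

open Classical in
/-- Upper bound for the probability that two graphs are both cocycles. -/
theorem sum_weight_evenOn_pair_le {G₁ G₂ : SimpleGraph (Fin n)} {b : Fin n}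
    (hb : ∀ x, ¬ (G₁ ⊔ G₂).Adj b x) (hn : 2 ≤ n) :
    (∑ A ∈ powersetCard ((n - 1).choose 2) univ, weight b A *
      (if ∀ t ∈ A, EvenOn G₁ t.1 ∧ EvenOn G₂ t.1 then 1 else 0)) /
        (n : ℝ) ^ ((n - 2).choose 2) ≤
      4 ^ (cherryTri (G₁ ⊔ G₂)).card / (n : ℝ) ^ (edges (G₁ ⊔ G₂)).card := by
  have hn0 : (0 : ℝ) < n := by exact_mod_cast (by omega : 0 < n)
  have hn1 : (1 : ℝ) ≤ n := by exact_mod_cast (by omega : 1 ≤ n)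
  set H := G₁ ⊔ G₂
  have hbt : ∀ t ∈ cherryTri H, b ∉ t.1 := by
    intro t ht hbt
    obtain ⟨u, x, y, -, hte, hux, huy⟩ := mem_cherryTri.1 ht
    rw [hte] at hbt
    simp only [mem_insert, mem_singleton] at hbt
    rcases hbt with rfl | rfl | rfl
    · exact hb _ hux
    · exact hb _ hux.symm
    · exact hb _ huy.symm
  have h1 := det_gram_one_add_le hn hbt
  rw [det_gram, card_row_bot] at h1
  rw [div_le_div_iff₀ (by positivity) (by positivity), Finset.sum_mul, mul_comm (4 ^ _)]
  -- Termwise comparison with the Cauchy–Binet expansion: a surviving `A` has at least |E(H)| cherry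
  -- triangles, each carrying weight 1 + n ≥ n.
  refine le_trans (Finset.sum_le_sum fun A _ => ?_) h1
  change _ ≤ _ * weight b A
  have hwA := weight_nonneg b A
  have hprod : ∏ t ∈ A, (if t ∈ cherryTri H then 1 + (n : ℝ) else 1) =
      (1 + (n : ℝ)) ^ (A ∩ cherryTri H).card := by
    rw [Finset.prod_ite, Finset.prod_const, Finset.prod_const_one, mul_one,
      Finset.filter_mem_eq_inter]
  rw [hprod]
  by_cases hA : ∀ t ∈ A, EvenOn G₁ t.1 ∧ EvenOn G₂ t.1
  · rw [if_pos hA, mul_one]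
    by_cases hw : weight b A = 0
    · simp [hw]
    · have h2 := card_edges_le_card_inter_cherryTri hb
        (fun t ht => mem_flagTri_or_mem_cherryTri (hA t ht).1 (hA t ht).2) hw
      rw [mul_comm]
      refine mul_le_mul_of_nonneg_right ?_ hwA
      calc (n : ℝ) ^ (edges H).card ≤ (n : ℝ) ^ (A ∩ cherryTri H).card :=
            pow_le_pow_right₀ hn1 h2
        _ ≤ _ := pow_le_pow_left₀ hn0.le (by linarith) _
  · rw [if_neg hA, mul_zero, zero_mul]
    positivity

end Pairs

/-! ### Counting vertices, edges, cherries and labellings -/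

section Counting

open Finset

variable {n h : ℕ}

section Union

variable {G₁ G₂ : SimpleGraph (Fin n)} {v₁ v₂ : Fin h × Fin 5 → Fin n}

theorem two_le_card_star {G H : SimpleGraph (Fin n)} {v : Fin h × Fin 5 → Fin n}
    (hG : IsFiveCycles G v) (hGH : G ≤ H) (p : Fin h × Fin 5) :
    2 ≤ ((edges H).filter fun e => v p ∈ e).card := by
  -- On a 5-cycle, four steps forward is the predecessor.
  set q := next (next (next (next p)))
  have hq : next q = p := next_five p
  have hpq : p ≠ q := by
    intro heq
    exact next_ne q (hq.trans heq)
  have hsub : ({{v p, v (next p)}, {v q, v (next q)}} : Finset (Finset (Fin n))) ⊆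
      (edges H).filter fun e => v p ∈ e := by
    intro e he
    simp only [Finset.mem_insert, Finset.mem_singleton] at he
    rw [mem_filter, mem_edges]
    rcases he with rfl | rfl
    · exact ⟨isEdge_pair.2 (hGH (hG.adj_next p)), by simp⟩
    · exact ⟨isEdge_pair.2 (hGH (hG.adj_next q)), by simp [hq]⟩
  refine le_trans (le_of_eq ?_) (Finset.card_le_card hsub)
  rw [Finset.card_pair]
  exact fun heq => hpq (pair_next_injective hG.inj heq)

theorem two_le_card_star_sup (h₁ : IsFiveCycles G₁ v₁) (h₂ : IsFiveCycles G₂ v₂) {u : Fin n}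
    (hu : u ∈ univ.image v₁ ∪ univ.image v₂) :
    2 ≤ ((edges (G₁ ⊔ G₂)).filter fun e => u ∈ e).card := by
  rcases mem_union.1 hu with hu | hu
  · obtain ⟨p, -, rfl⟩ := mem_image.1 hu
    exact two_le_card_star h₁ le_sup_left p
  · obtain ⟨p, -, rfl⟩ := mem_image.1 hu
    exact two_le_card_star h₂ le_sup_right p

theorem adj_sup_mem (h₁ : IsFiveCycles G₁ v₁) (h₂ : IsFiveCycles G₂ v₂) {x y : Fin n}
    (hxy : (G₁ ⊔ G₂).Adj x y) : x ∈ univ.image v₁ ∪ univ.image v₂ := by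
  rw [mem_union]
  rcases hxy with hxy | hxy
  · obtain ⟨p, ⟨rfl, -⟩ | ⟨rfl, -⟩⟩ := h₁.adj_iff.1 hxy <;>
      exact Or.inl (mem_image_of_mem _ (mem_univ _))
  · obtain ⟨p, ⟨rfl, -⟩ | ⟨rfl, -⟩⟩ := h₂.adj_iff.1 hxy <;>
      exact Or.inr (mem_image_of_mem _ (mem_univ _))

/-- Handshake: each edge of the union has both endpoints in the vertex set. -/
theorem sum_card_star (h₁ : IsFiveCycles G₁ v₁) (h₂ : IsFiveCycles G₂ v₂) :
    ∑ u ∈ univ.image v₁ ∪ univ.image v₂, ((edges (G₁ ⊔ G₂)).filter fun e => u ∈ e).card =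
      (edges (G₁ ⊔ G₂)).card * 2 := by
  have h := Finset.sum_card_bipartiteAbove_eq_sum_card_bipartiteBelow
    (s := univ.image v₁ ∪ univ.image v₂) (t := edges (G₁ ⊔ G₂)) (fun u e => u ∈ e)
  unfold Finset.bipartiteAbove Finset.bipartiteBelow at h
  rw [h]
  refine Finset.sum_const_nat fun e he => ?_
  obtain ⟨x, y, hxy, rfl⟩ := mem_edges.1 he
  rw [← Finset.card_pair hxy.ne]
  congr 1
  ext z
  simp only [mem_filter, Finset.mem_insert, Finset.mem_singleton, and_iff_right_iff_imp]
  rintro (rfl | rfl)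
  · exact adj_sup_mem h₁ h₂ hxy
  · exact adj_sup_mem h₁ h₂ hxy.symm

theorem card_union_le_card_edges (h₁ : IsFiveCycles G₁ v₁) (h₂ : IsFiveCycles G₂ v₂) :
    (univ.image v₁ ∪ univ.image v₂).card ≤ (edges (G₁ ⊔ G₂)).card := by
  have h := sum_card_star h₁ h₂
  have h3 := Finset.card_nsmul_le_sum (univ.image v₁ ∪ univ.image v₂)
    (fun u => ((edges (G₁ ⊔ G₂)).filter fun e => u ∈ e).card) 2
    fun u hu => two_le_card_star_sup h₁ h₂ hu
  rw [smul_eq_mul] at h3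
  omega

/-- Equality in the degree count makes the union 2-regular, so a cherry is determined by its centre.
-/
theorem card_cherryTri_le_of_card_eq (h₁ : IsFiveCycles G₁ v₁) (h₂ : IsFiveCycles G₂ v₂)
    (heq : (univ.image v₁ ∪ univ.image v₂).card = (edges (G₁ ⊔ G₂)).card) :
    (cherryTri (G₁ ⊔ G₂)).card ≤ (univ.image v₁ ∪ univ.image v₂).card := by
  set V := univ.image v₁ ∪ univ.image v₂
  have hstar : ∀ u ∈ V, 2 = ((edges (G₁ ⊔ G₂)).filter fun e => u ∈ e).card := by
    rw [← Finset.sum_eq_sum_iff_of_le fun u hu => two_le_card_star_sup h₁ h₂ hu,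
      sum_card_star h₁ h₂, ← heq, Finset.sum_const, smul_eq_mul]
  refine (Finset.card_le_card_of_injOn (t := V.image fun u =>
    ((edges (G₁ ⊔ G₂)).filter fun e => u ∈ e).biUnion id) Subtype.val ?_
    Subtype.val_injective.injOn).trans Finset.card_image_le
  intro t ht
  obtain ⟨u, x, y, hxy, hte, hux, huy⟩ := mem_cherryTri.1 ht
  have huV : u ∈ V := adj_sup_mem h₁ h₂ hux
  refine Finset.mem_coe.2 (mem_image.2 ⟨u, huV, ?_⟩)
  have hsub : ({{u, x}, {u, y}} : Finset (Finset (Fin n))) ⊆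
      (edges (G₁ ⊔ G₂)).filter fun e => u ∈ e := by
    intro e he
    simp only [Finset.mem_insert, Finset.mem_singleton] at he
    rw [mem_filter, mem_edges]
    rcases he with rfl | rfl
    · exact ⟨isEdge_pair.2 hux, by simp⟩
    · exact ⟨isEdge_pair.2 huy, by simp⟩
  rw [← Finset.eq_of_subset_of_card_le hsub
    (by rw [← hstar u huV, Finset.card_pair (pair_ne_pair hxy)]), hte]
  ext w
  simp

/-- A crude bound suffices when there are more edges than vertices: the extra 1/n absorbs any
constant depending only on `h`. -/
theorem card_cherryTri_le (h₁ : IsFiveCycles G₁ v₁) (h₂ : IsFiveCycles G₂ v₂) :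
    (cherryTri (G₁ ⊔ G₂)).card ≤ (univ.image v₁ ∪ univ.image v₂).card ^ 3 := by
  refine le_trans (Finset.card_le_card_of_injOn
    (t := powersetCard 3 (univ.image v₁ ∪ univ.image v₂)) Subtype.val ?_
    Subtype.val_injective.injOn) ?_
  · intro t ht
    refine Finset.mem_coe.2 (mem_powersetCard.2 ⟨?_, t.2⟩)
    obtain ⟨u, x, y, hxy, hte, hux, huy⟩ := mem_cherryTri.1 ht
    rw [hte]
    intro z hz
    simp only [Finset.mem_insert, Finset.mem_singleton] at hz
    rcases hz with rfl | rfl | rfl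
    · exact adj_sup_mem h₁ h₂ hux
    · exact adj_sup_mem h₁ h₂ hux.symm
    · exact adj_sup_mem h₁ h₂ huy.symm
  · rw [card_powersetCard]
    exact Nat.choose_le_pow _ _

theorem card_image_union_le (v₁ v₂ : Fin h × Fin 5 → Fin n) :
    (univ.image v₁ ∪ univ.image v₂).card ≤ 10 * h := by
  have h1 := Finset.card_union_le (univ.image v₁) (univ.image v₂)
  have h2 := Finset.card_image_le (s := univ) (f := v₁)
  have h3 := Finset.card_image_le (s := univ) (f := v₂)
  simp only [Finset.card_univ, Fintype.card_prod, Fintype.card_fin] at h2 h3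
  omega

/-- The first summand covers |V| = |E|, with at most 10h cherries; the second covers |V| < |E|, with
one spare power of n. -/
theorem pow_cherryTri_div_le (h₁ : IsFiveCycles G₁ v₁) (h₂ : IsFiveCycles G₂ v₂) (hn : 1 ≤ n) :
    (4 : ℝ) ^ (cherryTri (G₁ ⊔ G₂)).card / (n : ℝ) ^ (edges (G₁ ⊔ G₂)).card ≤
      (4 ^ (10 * h) + 4 ^ ((10 * h) ^ 3) / n) *
        ((n : ℝ)⁻¹) ^ (univ.image v₁ ∪ univ.image v₂).card := by
  have hn0 : (0 : ℝ) < n := by exact_mod_cast hn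
  have hn1 : (1 : ℝ) ≤ n := by exact_mod_cast hn
  have hV := card_image_union_le v₁ v₂
  rw [inv_pow, ← div_eq_mul_inv]
  rcases (card_union_le_card_edges h₁ h₂).eq_or_lt with heq | hlt
  · rw [← heq]
    refine div_le_div_of_nonneg_right ?_ (by positivity)
    have h1 : (4 : ℝ) ^ (cherryTri (G₁ ⊔ G₂)).card ≤ 4 ^ (10 * h) :=
      pow_le_pow_right₀ (by norm_num) ((card_cherryTri_le_of_card_eq h₁ h₂ heq).trans hV)
    have h2 : (0 : ℝ) ≤ 4 ^ ((10 * h) ^ 3) / n := by positivity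
    linarith
  · set V := univ.image v₁ ∪ univ.image v₂
    have h1 : (4 : ℝ) ^ (cherryTri (G₁ ⊔ G₂)).card ≤ 4 ^ ((10 * h) ^ 3) :=
      pow_le_pow_right₀ (by norm_num) ((card_cherryTri_le h₁ h₂).trans
        (Nat.pow_le_pow_left hV 3))
    have h2 : (n : ℝ) ^ (V.card + 1) ≤ (n : ℝ) ^ (edges (G₁ ⊔ G₂)).card :=
      pow_le_pow_right₀ hn1 hlt
    calc (4 : ℝ) ^ (cherryTri (G₁ ⊔ G₂)).card / (n : ℝ) ^ (edges (G₁ ⊔ G₂)).card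
        ≤ 4 ^ ((10 * h) ^ 3) / (n : ℝ) ^ (V.card + 1) :=
          div_le_div₀ (by positivity) h1 (by positivity) h2
      _ = 4 ^ ((10 * h) ^ 3) / n / (n : ℝ) ^ V.card := by
          rw [pow_succ' (n : ℝ) V.card, div_div]
      _ ≤ _ := by
          refine div_le_div_of_nonneg_right ?_ (by positivity)
          have : (0 : ℝ) ≤ 4 ^ (10 * h) := by positivity
          linarith

end Union

open Classical in
/-- The injective labellings of the vertices of `h` disjoint 5-cycles. -/
def labellings (n h : ℕ) : Finset (Fin h × Fin 5 → Fin n) := univ.filter Function.Injective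

theorem mem_labellings {v : Fin h × Fin 5 → Fin n} : v ∈ labellings n h ↔ Function.Injective v := by
  simp [labellings]

/-- The union of 5-cycles labelled by `v`. -/
def cycleGraphOf (v : Fin h × Fin 5 → Fin n) : SimpleGraph (Fin n) :=
  SimpleGraph.fromEdgeSet (Set.range fun p => s(v p, v (next p)))

theorem isFiveCycles_cycleGraphOf {v : Fin h × Fin 5 → Fin n} (hv : Function.Injective v) :
    IsFiveCycles (cycleGraphOf v) v := by
  refine ⟨hv, ?_⟩
  rw [cycleGraphOf, SimpleGraph.edgeSet_fromEdgeSet]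
  refine sdiff_eq_left.2 (Set.disjoint_left.2 ?_)
  rintro _ ⟨p, rfl⟩ hdiag
  exact (triple_next_distinct hv p).1 (by simpa using hdiag)

theorem IsFiveCycles.eq_cycleGraphOf {G : SimpleGraph (Fin n)} {v : Fin h × Fin 5 → Fin n}
    (hG : IsFiveCycles G v) : cycleGraphOf v = G :=
  SimpleGraph.edgeSet_injective
    ((isFiveCycles_cycleGraphOf hG.inj).edgeSet_eq.trans hG.edgeSet_eq.symm)

theorem mem_fiveCycleFinset {G : SimpleGraph (Fin n)} :
    G ∈ fiveCycleFinset n h ↔ ∃ v : Fin h × Fin 5 → Fin n, IsFiveCycles G v := by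
  simp only [fiveCycleFinset, mem_filter, mem_univ, true_and]
  constructor
  · rintro ⟨v, hv, he⟩
    exact ⟨v, hv, he⟩
  · rintro ⟨v, hv, he⟩
    exact ⟨v, hv, he⟩

theorem mapsTo_cycleGraphOf : Set.MapsTo cycleGraphOf (labellings n h : Set (Fin h × Fin 5 → Fin n))
    (fiveCycleFinset n h : Set (SimpleGraph (Fin n))) := fun v hv =>
  Finset.mem_coe.2 (mem_fiveCycleFinset.2 ⟨v, isFiveCycles_cycleGraphOf (mem_labellings.1 hv)⟩)

theorem isFiveCycles_comp_perm {G : SimpleGraph (Fin n)} {v : Fin h × Fin 5 → Fin n}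
    (hG : IsFiveCycles G v) (σ : Equiv.Perm (Fin h)) :
    IsFiveCycles G (fun p => v (σ p.1, p.2)) := by
  refine ⟨?_, ?_⟩
  · rintro ⟨i, j⟩ ⟨i', j'⟩ hp
    have h1 := hG.inj hp
    simp only [Prod.mk.injEq, EmbeddingLike.apply_eq_iff_eq] at h1
    rw [h1.1, h1.2]
  · rw [hG.edgeSet_eq]
    refine ((σ.prodCongr (Equiv.refl (Fin 5))).surjective.range_comp _).symm.trans ?_
    rfl

open Classical in
-- Permuting the `h` cycles does not change the graph. Rotations and reflections of single cycles
-- are not needed for this bound.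
theorem factorial_le_card_fiber {G : SimpleGraph (Fin n)} (hG : G ∈ fiveCycleFinset n h) :
    h ! ≤ ((labellings n h).filter fun v => cycleGraphOf v = G).card := by
  obtain ⟨v, hv⟩ := mem_fiveCycleFinset.1 hG
  have hc : Fintype.card (Equiv.Perm (Fin h)) = h ! := by
    rw [Fintype.card_perm, Fintype.card_fin]
  rw [← hc, ← Finset.card_univ]
  refine Finset.card_le_card_of_injOn (fun (σ : Equiv.Perm (Fin h)) p => v (σ p.1, p.2)) ?_ ?_
  · intro σ _
    refine Finset.mem_coe.2 (mem_filter.2 ⟨?_, ?_⟩)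
    · exact mem_labellings.2 (isFiveCycles_comp_perm hv σ).inj
    · exact (isFiveCycles_comp_perm hv σ).eq_cycleGraphOf
  · intro σ _ τ _ hστ
    ext i
    have h1 := hv.inj (congrFun hστ (i, 0))
    simp only [Prod.mk.injEq, and_true] at h1
    rw [h1]

/-- In a cycle, each vertex has only one neighbour besides the one just left, so two consecutive
labels determine the next. -/
theorem eq_of_eq_of_eq_next {G : SimpleGraph (Fin n)} {v w : Fin h × Fin 5 → Fin n}
    (hv : IsFiveCycles G v) (hw : IsFiveCycles G w) {p : Fin h × Fin 5} (h0 : v p = w p)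
    (h1 : v (next p) = w (next p)) : v (next (next p)) = w (next (next p)) := by
  have hadj := hw.adj_next (next p)
  rw [← h1] at hadj
  obtain ⟨q, ⟨h2, h3⟩ | ⟨h2, h3⟩⟩ := hv.adj_iff.1 hadj
  · rw [h3, hv.inj h2]
  · rw [← next_injective (hv.inj h2), h0] at h3
    exact absurd (hw.inj h3) (next_next_ne p)

open Classical in
-- A labelling is determined by the first directed edge of each of its `h` cycles, and the graph has
-- at most 10h directed edges.
theorem card_fiber_le (G : SimpleGraph (Fin n)) :
    ((labellings n h).filter fun v => cycleGraphOf v = G).card ≤ (10 * h) ^ h := by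
  rcases ((labellings n h).filter fun v => cycleGraphOf v = G).eq_empty_or_nonempty with he | hne
  · rw [he]; simp
  obtain ⟨v₀, hv₀⟩ := hne
  have hfive : ∀ v ∈ (labellings n h).filter fun v => cycleGraphOf v = G, IsFiveCycles G v := by
    intro v hv
    obtain ⟨h1, h2⟩ := mem_filter.1 hv
    rw [← h2]
    exact isFiveCycles_cycleGraphOf (mem_labellings.1 h1)
  have h₀ := hfive v₀ hv₀
  let D : Finset (Fin n × Fin n) := univ.image fun q : (Fin h × Fin 5) × Bool =>
    if q.2 then (v₀ q.1, v₀ (next q.1)) else (v₀ (next q.1), v₀ q.1)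
  have hD : D.card ≤ 10 * h := by
    refine Finset.card_image_le.trans ?_
    simp only [Finset.card_univ, Fintype.card_prod, Fintype.card_fin, Fintype.card_bool]
    omega
  have hcard : (Fintype.piFinset fun _ : Fin h => D).card = D.card ^ h := by
    rw [Fintype.card_piFinset, Finset.prod_const, Finset.card_univ, Fintype.card_fin]
  refine le_trans (Finset.card_le_card_of_injOn (t := Fintype.piFinset fun _ : Fin h => D)
    (fun v i => (v (i, 0), v (next (i, 0)))) ?_ ?_) (hcard.le.trans (Nat.pow_le_pow_left hD h))
  · intro v hv
    refine Finset.mem_coe.2 (Fintype.mem_piFinset.2 fun i => ?_)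
    obtain ⟨q, ⟨h1, h2⟩ | ⟨h1, h2⟩⟩ := h₀.adj_iff.1 ((hfive v hv).adj_next (i, 0))
    · exact mem_image.2 ⟨(q, true), mem_univ _, by simp [h1, h2]⟩
    · exact mem_image.2 ⟨(q, false), mem_univ _, by simp [h1, h2]⟩
  · intro v hv w hw hvw
    have hv' := hfive v hv
    have hw' := hfive w hw
    funext p
    obtain ⟨i, j⟩ := p
    have h1 := congrFun hvw i
    simp only [Prod.mk.injEq] at h1
    obtain ⟨e0, e1⟩ := h1
    have e2 := eq_of_eq_of_eq_next hv' hw' e0 e1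
    have e3 := eq_of_eq_of_eq_next hv' hw' e1 e2
    have e4 := eq_of_eq_of_eq_next hv' hw' e2 e3
    fin_cases j
    · exact e0
    · exact e1
    · exact e2
    · exact e3
    · exact e4

theorem factorial_mul_sum_le (F : SimpleGraph (Fin n) → ℝ) (hF : ∀ G, 0 ≤ F G) :
    (h ! : ℝ) * ∑ G ∈ fiveCycleFinset n h, F G ≤ ∑ v ∈ labellings n h, F (cycleGraphOf v) := by
  classical
  rw [← Finset.sum_fiberwise_of_maps_to (g := cycleGraphOf) (t := fiveCycleFinset n h)
    (fun v hv => mapsTo_cycleGraphOf hv), Finset.mul_sum]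
  refine Finset.sum_le_sum fun G hG => ?_
  rw [Finset.sum_congr rfl fun v hv => by rw [(mem_filter.1 hv).2], Finset.sum_const,
    nsmul_eq_mul]
  exact mul_le_mul_of_nonneg_right (by exact_mod_cast factorial_le_card_fiber hG) (hF G)

theorem card_labellings (n h : ℕ) : (labellings n h).card = n.descFactorial (5 * h) := by
  classical
  have h1 := Fintype.card_embedding_eq (α := Fin h × Fin 5) (β := Fin n)
  rw [Fintype.card_fin, Fintype.card_prod, Fintype.card_fin, Fintype.card_fin, mul_comm h 5] at h1
  rw [← h1, labellings, ← Fintype.card_subtype]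
  exact Fintype.card_congr (Equiv.subtypeInjectiveEquivEmbedding _ _)

theorem descFactorial_le_card_fiveCycleFinset (n h : ℕ) :
    n.descFactorial (5 * h) ≤ (10 * h) ^ h * (fiveCycleFinset n h).card := by
  classical
  rw [← card_labellings]
  exact Finset.card_le_mul_card_image_of_maps_to (fun v hv => mapsTo_cycleGraphOf hv) _
    fun G _ => card_fiber_le G

/-- Each label of `v₂` costs 1 if it lands in the image of `v₁` and 1/n otherwise. After dropping
injectivity the sum is a product of 5h equal factors, each at most 5h · 1 + n · (1/n). -/
theorem sum_labellings_inv_pow_le (hn : 1 ≤ n) {v₁ : Fin h × Fin 5 → Fin n}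
    (hv₁ : Function.Injective v₁) :
    ∑ v₂ ∈ labellings n h, ((n : ℝ)⁻¹) ^ (univ.image v₁ ∪ univ.image v₂).card ≤
      ((n : ℝ)⁻¹) ^ (5 * h) * (5 * h + 1) ^ (5 * h) := by
  classical
  have hn0 : (0 : ℝ) < n := by exact_mod_cast hn
  set I := univ.image v₁ with hI
  have hIc : I.card = 5 * h := by
    rw [hI, Finset.card_image_of_injective _ hv₁]; simp [mul_comm]
  have hterm : ∀ v₂ ∈ labellings n h, ((n : ℝ)⁻¹) ^ (I ∪ univ.image v₂).card =
      ((n : ℝ)⁻¹) ^ (5 * h) * ∏ p, if v₂ p ∈ I then 1 else (n : ℝ)⁻¹ := by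
    intro v₂ hv₂
    have hc : (I ∪ univ.image v₂).card =
        5 * h + (univ.filter fun p => ¬ v₂ p ∈ I).card := by
      rw [← Finset.union_sdiff_self_eq_union, Finset.card_union_of_disjoint Finset.disjoint_sdiff,
        hIc]
      congr 1
      rw [← Finset.card_image_of_injective (univ.filter fun p => ¬ v₂ p ∈ I)
        (mem_labellings.1 hv₂)]
      congr 1
      ext x
      simp only [Finset.mem_sdiff, mem_image, mem_univ, true_and, mem_filter]
      constructor
      · rintro ⟨⟨p, rfl⟩, hp⟩
        exact ⟨p, hp, rfl⟩
      · rintro ⟨p, hp, rfl⟩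
        exact ⟨⟨p, rfl⟩, hp⟩
    rw [hc, pow_add, Finset.prod_ite, Finset.prod_const_one, one_mul, Finset.prod_const]
  rw [Finset.sum_congr rfl hterm, ← Finset.mul_sum]
  refine mul_le_mul_of_nonneg_left ?_ (by positivity)
  have hsum : ∑ x : Fin n, (if x ∈ I then 1 else (n : ℝ)⁻¹) ≤ 5 * h + 1 := by
    calc ∑ x : Fin n, (if x ∈ I then 1 else (n : ℝ)⁻¹)
        ≤ ∑ x : Fin n, ((if x ∈ I then 1 else 0) + (n : ℝ)⁻¹) := by
          refine Finset.sum_le_sum fun x _ => ?_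
          have : (0 : ℝ) ≤ (n : ℝ)⁻¹ := by positivity
          split_ifs <;> linarith
      _ = 5 * h + 1 := by
          rw [Finset.sum_add_distrib, Finset.sum_boole, Finset.filter_mem_eq_inter,
            Finset.univ_inter, hIc, Finset.sum_const, Finset.card_univ, Fintype.card_fin,
            nsmul_eq_mul, mul_inv_cancel₀ hn0.ne']
          push_cast
          ring
  calc ∑ v₂ ∈ labellings n h, ∏ p, (if v₂ p ∈ I then 1 else (n : ℝ)⁻¹)
      ≤ ∑ v₂ : Fin h × Fin 5 → Fin n, ∏ p, (if v₂ p ∈ I then 1 else (n : ℝ)⁻¹) := by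
        refine Finset.sum_le_sum_of_subset_of_nonneg (Finset.subset_univ _) fun v _ _ => ?_
        refine Finset.prod_nonneg fun p _ => ?_
        split_ifs <;> positivity
    _ = ∏ _p : Fin h × Fin 5, ∑ x : Fin n, (if x ∈ I then 1 else (n : ℝ)⁻¹) := by
        rw [Finset.prod_univ_sum, Fintype.piFinset_univ]
    _ = (∑ x : Fin n, (if x ∈ I then 1 else (n : ℝ)⁻¹)) ^ (5 * h) := by
        rw [Finset.prod_const]; simp [mul_comm]
    _ ≤ (5 * h + 1) ^ (5 * h) := by
        refine pow_le_pow_left₀ (Finset.sum_nonneg fun x _ => ?_) hsum _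
        split_ifs <;> positivity

theorem sum_labellings_pair_le (hn : 1 ≤ n) :
    ∑ v₁ ∈ labellings n h, ∑ v₂ ∈ labellings n h,
      ((n : ℝ)⁻¹) ^ (univ.image v₁ ∪ univ.image v₂).card ≤ (5 * h + 1) ^ (5 * h) := by
  have hn0 : (0 : ℝ) < n := by exact_mod_cast hn
  calc _ ≤ ∑ _v₁ ∈ labellings n h, ((n : ℝ)⁻¹) ^ (5 * h) * (5 * h + 1) ^ (5 * h) :=
        Finset.sum_le_sum fun v₁ hv₁ => sum_labellings_inv_pow_le hn (mem_labellings.1 hv₁)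
    _ = ((labellings n h).card * ((n : ℝ)⁻¹) ^ (5 * h)) * (5 * h + 1) ^ (5 * h) := by
        rw [Finset.sum_const, nsmul_eq_mul, mul_assoc]
    _ ≤ 1 * (5 * h + 1) ^ (5 * h) := by
        refine mul_le_mul_of_nonneg_right ?_ (by positivity)
        rw [card_labellings, inv_pow, ← div_eq_mul_inv, div_le_one (by positivity)]
        exact_mod_cast Nat.descFactorial_le_pow n (5 * h)
    _ = _ := one_mul _

end Counting

/-! ### The two moment bounds -/

section Moments

open Finset

variable {n h : ℕ}

open Classical in
/-- An isolated vertex of `G`, if there is one. -/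
def isolatedVertex [NeZero n] (G : SimpleGraph (Fin n)) : Fin n :=
  if hG : ∃ b, ∀ x, ¬ G.Adj b x then hG.choose else 0

theorem not_adj_isolatedVertex [NeZero n] {G : SimpleGraph (Fin n)} {V : Finset (Fin n)}
    (hV : ∀ x y, G.Adj x y → x ∈ V) (hVn : V.card < n) (x : Fin n) :
    ¬ G.Adj (isolatedVertex G) x := by
  have hex : ∃ b, ∀ x, ¬ G.Adj b x := by
    obtain ⟨b, hb⟩ : ∃ b, b ∉ V := by
      by_contra! hcon
      have : V = univ := Finset.eq_univ_iff_forall.2 hcon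
      rw [this, Finset.card_univ, Fintype.card_fin] at hVn
      exact lt_irrefl _ hVn
    exact ⟨b, fun x hx => hb (hV b x hx)⟩
  unfold isolatedVertex
  rw [dif_pos hex]
  exact hex.choose_spec x

/-- Bernoulli: (1 - 5h/n)^(5h) ≥ 1 - 25h²/n, which is at least 1/2 once n ≥ 50h². -/
theorem half_pow_le_descFactorial (hh : 0 < h) (hn : 50 * h ^ 2 ≤ n) :
    (n : ℝ) ^ (5 * h) / 2 ≤ n.descFactorial (5 * h) := by
  have hhn : 5 * h ≤ n := by nlinarith
  have hn0 : (0 : ℝ) < n := by exact_mod_cast (by nlinarith : 0 < n)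
  have h1 : (n - 5 * h) ^ (5 * h) ≤ n.descFactorial (5 * h) :=
    (Nat.pow_le_pow_left (by omega) _).trans (Nat.pow_sub_le_descFactorial n (5 * h))
  have h2 : ((n : ℝ) - 5 * h) ^ (5 * h) ≤ n.descFactorial (5 * h) := by
    have h3 : (((n - 5 * h) ^ (5 * h) : ℕ) : ℝ) ≤ (n.descFactorial (5 * h) : ℕ) := by
      exact_mod_cast h1
    push_cast [hhn] at h3
    exact h3
  refine le_trans ?_ h2
  have hnr : 50 * (h : ℝ) ^ 2 ≤ n := by exact_mod_cast hn
  have hhr : (1 : ℝ) ≤ h := by exact_mod_cast hh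
  set x : ℝ := 5 * h / n with hx
  have hx1 : x * (5 * h) ≤ 1 / 2 := by
    rw [hx, div_mul_eq_mul_div, div_le_iff₀ hn0]
    nlinarith
  have hxle : x ≤ 1 := by
    have hx0 : 0 ≤ x := by positivity
    nlinarith
  have hb := one_add_mul_le_pow (a := -x) (by linarith) (5 * h)
  have heq : (n : ℝ) - 5 * h = n * (1 + -x) := by rw [hx]; field_simp; ring
  rw [heq, mul_pow, div_eq_mul_inv]
  refine mul_le_mul_of_nonneg_left ?_ (by positivity)
  refine le_trans ?_ hb
  push_cast
  linarith

/-- From h^h ≤ e^h h!, 10 ≤ e^9 and 2 ≤ e^h, the total loss is e^(11h), well within the gap between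
30h and 100h. -/
theorem exp_div_factorial_le (hh : 0 < h) :
    Real.exp (-100 * h) / (h ! : ℝ) ≤ Real.exp (-(30 * h)) / 2 / (10 * h) ^ h := by
  have hh0 : (0 : ℝ) < h := by exact_mod_cast hh
  have h1 : (h : ℝ) ^ h ≤ Real.exp h * h ! := by
    have := Real.pow_div_factorial_le_exp (h : ℝ) hh0.le h
    rwa [div_le_iff₀ (by positivity)] at this
  have h2 : (10 : ℝ) ^ h ≤ Real.exp (9 * h) := by
    have : (10 : ℝ) ≤ Real.exp 9 := by linarith [Real.add_one_le_exp (9 : ℝ)]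
    calc (10 : ℝ) ^ h ≤ Real.exp 9 ^ h := pow_le_pow_left₀ (by norm_num) this h
      _ = _ := by rw [← Real.exp_nat_mul]; ring_nf
  have h3 : (2 : ℝ) ≤ Real.exp h := by
    have : (1 : ℝ) ≤ h := by exact_mod_cast hh
    linarith [Real.add_one_le_exp (h : ℝ)]
  rw [div_div, div_le_div_iff₀ (by positivity) (by positivity)]
  calc Real.exp (-100 * h) * (2 * (10 * h) ^ h)
      ≤ Real.exp (-100 * h) * (Real.exp h * (Real.exp (9 * h) * (Real.exp h * h !))) := by
        rw [mul_pow]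
        gcongr
    _ = Real.exp (-100 * h + h + 9 * h + h) * h ! := by
        rw [Real.exp_add, Real.exp_add, Real.exp_add]; ring
    _ ≤ Real.exp (-(30 * h)) * h ! := by
        gcongr
        linarith

theorem le_integral_X (hh : 0 < h) (hn : 50 * h ^ 2 ≤ n) :
    Real.exp (-100 * h) / (h ! : ℝ) ≤ ∫ S, (X h S : ℝ) ∂(law n) := by
  classical
  have hn30 : 30 * h ≤ n := by nlinarith
  have : NeZero n := ⟨by omega⟩
  have hn0 : (0 : ℝ) < n := by exact_mod_cast (by omega : 0 < n)
  have hh0 : (0 : ℝ) < h := by exact_mod_cast hh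
  rw [integral_X h isolatedVertex]
  refine (exp_div_factorial_le hh).trans ?_
  have h1 : ∀ G ∈ fiveCycleFinset n h, Real.exp (-(30 * h)) / (n : ℝ) ^ (5 * h) ≤
      weight (isolatedVertex G) (univ.filter fun t => EvenOn G t.1) /
        (n : ℝ) ^ ((n - 2).choose 2) := by
    intro G hG
    obtain ⟨v, hv⟩ := mem_fiveCycleFinset.1 hG
    refine le_weight_evenOn_div hv (fun p hp => ?_) hh hn30
    refine not_adj_isolatedVertex (V := univ.image v) ?_ ?_ (v (next p)) (hp ▸ hv.adj_next p)
    · intro x y hxy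
      obtain ⟨p, ⟨rfl, -⟩ | ⟨rfl, -⟩⟩ := hv.adj_iff.1 hxy <;>
        exact mem_image_of_mem _ (mem_univ _)
    · refine Finset.card_image_le.trans_lt ?_
      simp only [Finset.card_univ, Fintype.card_prod, Fintype.card_fin]
      omega
  refine le_trans ?_ (Finset.sum_le_sum h1)
  rw [Finset.sum_const, nsmul_eq_mul]
  have h2 : (n : ℝ) ^ (5 * h) / 2 ≤ (10 * h) ^ h * (fiveCycleFinset n h).card := by
    refine (half_pow_le_descFactorial hh hn).trans ?_
    exact_mod_cast descFactorial_le_card_fiveCycleFinset n h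
  rw [div_div, mul_div_assoc', div_le_div_iff₀ (by positivity) (by positivity)]
  have h3 := mul_le_mul_of_nonneg_left h2 (Real.exp_pos (-(30 * (h : ℝ)))).le
  linarith

/-- Here 5h + 1 ≤ 6h, 4^(10h) = 16^(5h) and 100 = 6 · 50/3. The slack 50/3 = 16(1 + 1/24) absorbs
the added 1, since 16^(5h) ≥ 24. -/
theorem sixteen_pow_add_one_le (hh : 0 < h) :
    ((4 : ℝ) ^ (10 * h) + 1) * (5 * h + 1) ^ (5 * h) ≤ (100 * h) ^ (5 * h) := by
  have hh1 : (1 : ℝ) ≤ h := by exact_mod_cast hh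
  have h1 : (5 * (h : ℝ) + 1) ^ (5 * h) ≤ (6 * h) ^ (5 * h) :=
    pow_le_pow_left₀ (by positivity) (by linarith) _
  have h2 : (4 : ℝ) ^ (10 * h) + 1 ≤ (50 / 3) ^ (5 * h) := by
    have h3 := one_add_mul_le_pow (a := (1 / 24 : ℝ)) (by norm_num) (5 * h)
    have h4 : (4 : ℝ) ^ (10 * h) = 16 ^ (5 * h) := by
      rw [show 10 * h = 2 * (5 * h) by ring, pow_mul]; norm_num
    have h5 : (50 / 3 : ℝ) ^ (5 * h) = 16 ^ (5 * h) * (1 + 1 / 24) ^ (5 * h) := by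
      rw [← mul_pow]; norm_num
    have h6 : (24 : ℝ) ≤ 16 ^ (5 * h) := by
      calc (24 : ℝ) ≤ 16 ^ 5 := by norm_num
        _ ≤ 16 ^ (5 * h) := pow_le_pow_right₀ (by norm_num) (by omega)
    rw [h4, h5]
    push_cast at h3
    have h7 : (1 : ℝ) + 1 / 24 ≤ (1 + 1 / 24) ^ (5 * h) := by linarith
    nlinarith
  calc ((4 : ℝ) ^ (10 * h) + 1) * (5 * h + 1) ^ (5 * h)
      ≤ (50 / 3) ^ (5 * h) * (6 * h) ^ (5 * h) := by gcongr
    _ = (100 * h) ^ (5 * h) := by rw [← mul_pow]; ring_nf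

theorem integral_X_sq_le (hh : 0 < h) (hn : 11 * h ≤ n) (hn4 : 4 ^ ((10 * h) ^ 3) ≤ n) :
    ∫ S, (X h S : ℝ) ^ 2 ∂(law n) ≤ (100 * (h : ℝ)) ^ (5 * h) / (h ! : ℝ) ^ 2 := by
  classical
  have : NeZero n := ⟨by omega⟩
  have hn0 : (0 : ℝ) < n := by exact_mod_cast (by omega : 0 < n)
  rw [integral_X_sq h fun G₁ G₂ => isolatedVertex (G₁ ⊔ G₂)]
  set F : SimpleGraph (Fin n) → SimpleGraph (Fin n) → ℝ := fun G₁ G₂ =>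
    4 ^ (cherryTri (G₁ ⊔ G₂)).card / (n : ℝ) ^ (edges (G₁ ⊔ G₂)).card with hF
  have hF0 : ∀ G₁ G₂, 0 ≤ F G₁ G₂ := fun G₁ G₂ => by positivity
  have h1 : ∀ G₁ ∈ fiveCycleFinset n h, ∀ G₂ ∈ fiveCycleFinset n h,
      (∑ A ∈ powersetCard ((n - 1).choose 2) univ, weight (isolatedVertex (G₁ ⊔ G₂)) A *
        (if ∀ t ∈ A, EvenOn G₁ t.1 ∧ EvenOn G₂ t.1 then 1 else 0)) /
          (n : ℝ) ^ ((n - 2).choose 2) ≤ F G₁ G₂ := by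
    intro G₁ hG₁ G₂ hG₂
    obtain ⟨v₁, hv₁⟩ := mem_fiveCycleFinset.1 hG₁
    obtain ⟨v₂, hv₂⟩ := mem_fiveCycleFinset.1 hG₂
    refine sum_weight_evenOn_pair_le (not_adj_isolatedVertex (fun x y => adj_sup_mem hv₁ hv₂)
      ?_) (by omega)
    have := card_image_union_le v₁ v₂
    omega
  refine (Finset.sum_le_sum fun G₁ hG₁ => Finset.sum_le_sum fun G₂ hG₂ =>
    h1 G₁ hG₁ G₂ hG₂).trans ?_
  rw [le_div_iff₀ (by positivity)]
  -- This is where `n` must be huge in terms of `h`: the pairs with more edges than vertices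
  -- contribute at most 1 to the constant.
  have hC : (4 : ℝ) ^ (10 * h) + 4 ^ ((10 * h) ^ 3) / n ≤ 4 ^ (10 * h) + 1 := by
    have : (4 : ℝ) ^ ((10 * h) ^ 3) / n ≤ 1 := by
      rw [div_le_one hn0]; exact_mod_cast hn4
    linarith
  calc (∑ G₁ ∈ fiveCycleFinset n h, ∑ G₂ ∈ fiveCycleFinset n h, F G₁ G₂) * (h ! : ℝ) ^ 2
      = (h ! : ℝ) * ∑ G₁ ∈ fiveCycleFinset n h,
          ((h ! : ℝ) * ∑ G₂ ∈ fiveCycleFinset n h, F G₁ G₂) := by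
        -- One factor h! is assigned to each graph, turning both sums over graphs into sums over
        -- labellings.
        rw [← Finset.mul_sum]; ring
    _ ≤ (h ! : ℝ) * ∑ G₁ ∈ fiveCycleFinset n h, ∑ v₂ ∈ labellings n h,
          F G₁ (cycleGraphOf v₂) := by
        gcongr with G₁ _
        exact factorial_mul_sum_le _ (hF0 G₁)
    _ ≤ ∑ v₁ ∈ labellings n h, ∑ v₂ ∈ labellings n h,
          F (cycleGraphOf v₁) (cycleGraphOf v₂) :=
        factorial_mul_sum_le (fun G₁ => ∑ v₂ ∈ labellings n h, F G₁ (cycleGraphOf v₂))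
          fun G₁ => Finset.sum_nonneg fun v₂ _ => hF0 _ _
    _ ≤ ∑ v₁ ∈ labellings n h, ∑ v₂ ∈ labellings n h,
          (4 ^ (10 * h) + 4 ^ ((10 * h) ^ 3) / n) *
            ((n : ℝ)⁻¹) ^ (univ.image v₁ ∪ univ.image v₂).card :=
        Finset.sum_le_sum fun v₁ hv₁ => Finset.sum_le_sum fun v₂ hv₂ =>
          pow_cherryTri_div_le (isFiveCycles_cycleGraphOf (mem_labellings.1 hv₁))
            (isFiveCycles_cycleGraphOf (mem_labellings.1 hv₂)) (by omega)
    _ = (4 ^ (10 * h) + 4 ^ ((10 * h) ^ 3) / n) *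
          ∑ v₁ ∈ labellings n h, ∑ v₂ ∈ labellings n h,
            ((n : ℝ)⁻¹) ^ (univ.image v₁ ∪ univ.image v₂).card := by
        simp_rw [Finset.mul_sum]
    _ ≤ (4 ^ (10 * h) + 1) * (5 * h + 1) ^ (5 * h) :=
        mul_le_mul hC (sum_labellings_pair_le (by omega))
          (Finset.sum_nonneg fun _ _ => Finset.sum_nonneg fun _ _ => by positivity)
          (by positivity)
    _ ≤ _ := sixteen_pow_add_one_le hh

end Moments

end DetHypertree

end

theorem theorem2 (h : ℕ) (hh : 0 < h) :
    ∀ᶠ n : ℕ in atTop,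
      Real.exp (-100 * h) / (h ! : ℝ) ≤ ∫ S, (DetHypertree.X h S : ℝ) ∂(DetHypertree.law n) ∧
      ∫ S, (DetHypertree.X h S : ℝ) ^ 2 ∂(DetHypertree.law n) ≤
        (100 * (h : ℝ)) ^ (5 * h) / (h ! : ℝ) ^ 2 := by
  filter_upwards [eventually_ge_atTop (50 * h ^ 2), eventually_ge_atTop (11 * h),
    eventually_ge_atTop (4 ^ ((10 * h) ^ 3))] with n h1 h2 h3
  exact ⟨DetHypertree.le_integral_X hh h1, DetHypertree.integral_X_sq_le hh h2 h3⟩
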